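/- For every $n$ let $\mathcal D_n=(d_1,\dots,d_n)$ be a sequence of non-negative integers such that, for all sufficiently large $n$, all $d_i\ge 1$ and $\mathcal D_n$ is feasible (some simple graph on $[n]=\{1,\dots,n\}$ gives every vertex $i$ the degree $d_i$). Let $G(\mathcal D_n)$ be a uniformly random simple graph on $[n]$ in which each vertex $i$ has degree $d_i$, and for $p\in[0,1]$ let $G(\mathcal D_n)_p$ be the random graph obtained from it by keeping each edge independently with probability $p$. Write $L_1(H)$ for the order (number of vertices) of a largest connected component of a graph $H$, $S_n(d)=\{i\in[n]: d_i\ge d\}$, and $d(U)=\sum_{i\in U}d_i$ for $U\subseteq V=[n]$. Let $d=d(n)$ be real, $p=p(n)\in[0,1]$, $S=S_n(d)$, and suppose that $\omega=\omega(n)\to\infty$ satisfies, for all sufficiently large $n$, $$pd\ge\omega^3\qquad\text{and}\qquad d(S)\ge\min\{\omega^3 d(V\setminus S),\,dn\}.$$ Let $V_\omega$ be the random set of the vertices whose degree in $G(\mathcal D_n)_p$ is at least $\omega$. Then there is an absolute constant $C>0$ (not depending on the sequences $\mathcal D_n,d,p,\omega$) such that, for all sufficiently large $n$, $$\mathbb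 P\Big[L_1(G(\mathcal D_n)_p)\ge(1-C\omega^{-1/2})\,\mathbb E|V_\omega|\Big]\ge 1-C\omega^{-1/2},$$ and, with probability at least $1-C\omega^{-1/2}$, some connected component of $G(\mathcal D_n)_p$ contains at least $(1-C\omega^{-1/2})|V_\omega|$ vertices of $V_\omega$. -/

import Mathlib

open Filter Topology MeasureTheory ProbabilityTheory

noncomputable section

/-- The set of all simple graphs on `Fin n` in which every vertex `i` has degree `D i`. -/
def realizations {n : ℕ} (D : Fin n → ℕ) : Set (SimpleGraph (Fin n)) :=
  {G | ∀ i, (G.neighborSet i).ncard = D i}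

/-- A degree sequence is feasible if at least one simple graph realizes it. -/
def IsFeasible {n : ℕ} (D : Fin n → ℕ) : Prop :=
  (realizations D).Nonempty

/-- The law of the `p`-percolation of a graph `G`: every edge of `G` is kept independently with
probability `p`. -/
def percolation {V : Type*} (G : SimpleGraph V) (p : unitInterval) : Measure (SimpleGraph V) :=
  (setBernoulli G.edgeSet p).map SimpleGraph.fromEdgeSet

/-- The law of the `p`-percolation of a uniformly random simple graph with degree sequence `D`:
first the graph is drawn uniformly from all realizations, then it is percolated. -/
def percolatedLaw {n : ℕ} (D : Fin n → ℕ) (p : unitInterval) : Measure (SimpleGraph (Fin n)) :=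
  (uniformOn (realizations D)).bind fun G => percolation G p

/-- The set of the vertices whose prescribed degree is at least `d`. -/
def largeDegree {n : ℕ} (D : Fin n → ℕ) (d : ℝ) : Finset (Fin n) :=
  {v | d ≤ (D v : ℝ)}

/-- The sum of the prescribed degrees over a set of vertices. -/
def degSum {n : ℕ} (D : Fin n → ℕ) (S : Finset (Fin n)) : ℝ :=
  ∑ v ∈ S, (D v : ℝ)

/-- The set of the vertices of degree at least `w` in the graph `H`; for the percolated graph `H`
this is the random set `V_w`. -/
def highVerts {n : ℕ} (H : SimpleGraph (Fin n)) (w : ℝ) : Set (Fin n) :=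
  {v | w ≤ ((H.neighborSet v).ncard : ℝ)}

/-- The order of a largest connected component of `H`. -/
def largestOrder {n : ℕ} (H : SimpleGraph (Fin n)) : ℕ :=
  ⨆ c : H.ConnectedComponent, c.supp.ncard

/-- The expected number of vertices of degree at least `w` in the percolated random graph. -/
def expectedHigh {n : ℕ} (D : Fin n → ℕ) (p : unitInterval) (w : ℝ) : ℝ :=
  ∫ H, ((highVerts H w).ncard : ℝ) ∂(percolatedLaw D p)

end

noncomputable section

/-! Write E for the edge set of the host graph, T for the percolated edges, and R = ω³. The
hypotheses yield a core W, either S or the whole vertex set, such that μ = p d(W) is at least R,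
R|W| and R p d(Wᶜ) (`exists_core`). So W has large average percolated degree, and few edges leave
it. Let L be the set of percolated edges inside W, and k = ⌈ω⌉. Four facts, each proved by a first
or second moment, give the result.

(1) |L| ≥ μ/4 with high probability, since |L| is binomial with mean at least μ/3.

(2) The expected number of pairs of oriented edges of L in different components is at most 32|W|μ ≤
32μ²/R (`totalExp_sepPair_le`). With (1), some component of L then has at least μ/20 edges
(`exists_large_component`).

(3) Summed over the vertices v of percolated degree at least k, the expected number of edges of L
that lie in components with at least μ/20 edges but are not joined to v is O(μQ/R), where Q is the
expected number of such v (`totalExp_farEdge_le`). By Markov, almost all of them are joined to the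
large component.

(4) The number of vertices of degree at least k has variance at most (k+1)Q, and Q ≥ R/4. The value
Q is the same for every realization E, since the law of a percolated degree depends only on the host
degree.

The bounds (2) and (3) rest on one dichotomy. Take percolated edges vb and cd in different
components. If vc and bd are not in E, replace vb, cd by vc, bd in both E and T. This keeps all
degrees, |T| and |E \ T|, so it preserves the joint law (`totalExp_switch_le`). Afterwards bd is a
bridge once vc is removed. Bridges form a forest, so there are at most 2|W| oriented ones inside W:
the switched configurations are rare. In (3) the vertex b may lie outside W; bd is then one of the
few edges leaving W.

If the switch is blocked, c is adjacent in E to v or b, say to x. Fix E and reveal the edges away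
from x (and from v). If the component of c contains m neighbours of x in E, all m edges from x to
them were deleted, which costs (1-p)^m (`bernExp_unreached_le`). The number of edges cd weighted by
(1-p)^m is O(|W|): bridges contribute at most 2|W|. A non-bridge can be deleted without changing
components, exchanging a factor 1-p for p and leaving p(1-p)^(m-1), and the binomial probability m p
(1-p)^(m-1) is at most 1. -/

namespace DegreePercolation

open Finset
open scoped Classical

set_option linter.unusedSectionVars false

/-! ### Expectations over random subsets of a finite set -/

section Bernoulli

variable {α : Type*} [DecidableEq α]

/-- The expectation of `F T`, where `T` is a random subset of the finite set `A` containing every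
element independently with probability `p`. -/
def bernExp (p : ℝ) (A : Finset α) (F : Finset α → ℝ) : ℝ :=
  ∑ T ∈ A.powerset, p ^ #T * (1 - p) ^ #(A \ T) * F T

variable {p : ℝ} {A B M : Finset α} {F F' : Finset α → ℝ} {e : α}

theorem bernExp_empty : bernExp p ∅ F = F ∅ := by
  simp [bernExp]

theorem bernExp_insert (he : e ∉ A) :
    bernExp p (insert e A) F = p * bernExp p A (fun T => F (insert e T)) +
      (1 - p) * bernExp p A F := by
  unfold bernExp
  rw [Finset.sum_powerset_insert he, mul_sum, mul_sum, add_comm]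
  congr 1
  · refine sum_congr rfl fun T hT => ?_
    have hT' := mem_powerset.1 hT
    have heT : e ∉ T := fun h => he (hT' h)
    rw [card_insert_of_notMem heT, insert_sdiff_insert, sdiff_insert_of_notMem he]
    ring
  · refine sum_congr rfl fun T hT => ?_
    have hT' := mem_powerset.1 hT
    have heT : e ∉ T := fun h => he (hT' h)
    rw [insert_sdiff_of_notMem _ heT, card_insert_of_notMem (by simp [he])]
    ring

theorem bernExp_congr (h : ∀ T ⊆ A, F T = F' T) : bernExp p A F = bernExp p A F' :=
  sum_congr rfl fun T hT => by rw [h T (mem_powerset.1 hT)]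

theorem bernExp_mono (h0 : 0 ≤ p) (h1 : p ≤ 1) (h : ∀ T ⊆ A, F T ≤ F' T) :
    bernExp p A F ≤ bernExp p A F' :=
  sum_le_sum fun T hT => mul_le_mul_of_nonneg_left (h T (mem_powerset.1 hT))
    (mul_nonneg (pow_nonneg h0 _) (pow_nonneg (by linarith) _))

theorem bernExp_const_mul (c : ℝ) : bernExp p A (fun T => c * F T) = c * bernExp p A F := by
  unfold bernExp
  rw [mul_sum]
  exact sum_congr rfl fun T _ => by ring

theorem bernExp_mul_const (c : ℝ) : bernExp p A (fun T => F T * c) = bernExp p A F * c := by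
  unfold bernExp
  rw [sum_mul]
  exact sum_congr rfl fun T _ => by ring

theorem bernExp_add : bernExp p A (fun T => F T + F' T) = bernExp p A F + bernExp p A F' := by
  unfold bernExp
  rw [← sum_add_distrib]
  exact sum_congr rfl fun T _ => by ring

theorem bernExp_sub : bernExp p A (fun T => F T - F' T) = bernExp p A F - bernExp p A F' := by
  unfold bernExp
  rw [← sum_sub_distrib]
  exact sum_congr rfl fun T _ => by ring

theorem bernExp_sum {ι : Type*} (s : Finset ι) (f : ι → Finset α → ℝ) :
    bernExp p A (fun T => ∑ i ∈ s, f i T) = ∑ i ∈ s, bernExp p A (f i) := by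
  unfold bernExp
  rw [sum_comm]
  exact sum_congr rfl fun T _ => by rw [mul_sum]

theorem bernExp_nonneg (h0 : 0 ≤ p) (h1 : p ≤ 1) (h : ∀ T ⊆ A, 0 ≤ F T) : 0 ≤ bernExp p A F :=
  sum_nonneg fun T hT => mul_nonneg
    (mul_nonneg (pow_nonneg h0 _) (pow_nonneg (by linarith) _)) (h T (mem_powerset.1 hT))

theorem bernExp_const (c : ℝ) : bernExp p A (fun _ => c) = c := by
  induction A using Finset.induction_on with
  | empty => simp [bernExp_empty]
  | insert a s ha ih => rw [bernExp_insert ha, ih]; ring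

theorem bernExp_union (hAB : Disjoint A B) (F : Finset α → ℝ) :
    bernExp p (A ∪ B) F = bernExp p A (fun S => bernExp p B (fun T => F (S ∪ T))) := by
  induction A using Finset.induction_on generalizing F with
  | empty => simp [bernExp_empty]
  | insert a s ha ih =>
    have hs : Disjoint s B := hAB.mono_left (subset_insert _ _)
    have haB : a ∉ B := disjoint_left.1 hAB (mem_insert_self _ _)
    rw [insert_union, bernExp_insert (by simp [ha, haB]), bernExp_insert ha, ih hs, ih hs]
    simp only [insert_union]

/-- A function of the trace of the random set on `B` can be integrated over `B` alone. -/
theorem bernExp_inter (hB : B ⊆ A) (F : Finset α → ℝ) :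
    bernExp p A (fun T => F (T ∩ B)) = bernExp p B F := by
  rw [← union_sdiff_of_subset hB, bernExp_union disjoint_sdiff]
  refine bernExp_congr fun S hS => ?_
  rw [← bernExp_const (p := p) (A := A \ B) (F S)]
  refine bernExp_congr fun T hT => ?_
  congr 1
  have hTB : Disjoint T B := disjoint_of_subset_left hT sdiff_disjoint
  rw [union_inter_distrib_right, inter_eq_left.2 hS, disjoint_iff_inter_eq_empty.1 hTB, union_empty]

theorem bernExp_mul_of_disjoint (hA : A ⊆ M) (hB : B ⊆ M) (hAB : Disjoint A B)
    (F F' : Finset α → ℝ) :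
    bernExp p M (fun T => F (T ∩ A) * F' (T ∩ B)) = bernExp p A F * bernExp p B F' := by
  have h : bernExp p M (fun T => F (T ∩ A) * F' (T ∩ B)) =
      bernExp p (A ∪ B) (fun T => F (T ∩ A) * F' (T ∩ B)) := by
    rw [← bernExp_inter (union_subset hA hB)]
    refine bernExp_congr fun T _ => ?_
    rw [inter_assoc, inter_assoc, inter_eq_right.2 subset_union_left,
      inter_eq_right.2 subset_union_right]
  rw [h, bernExp_union hAB, ← bernExp_mul_const]
  refine bernExp_congr fun S hS => ?_
  rw [← bernExp_const_mul]
  refine bernExp_congr fun T hT => ?_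
  have h1 : Disjoint T A := (disjoint_of_subset_left hT hAB.symm)
  have h2 : Disjoint S B := (disjoint_of_subset_left hS hAB)
  rw [union_inter_distrib_right, union_inter_distrib_right, inter_eq_left.2 hS,
    inter_eq_left.2 hT, disjoint_iff_inter_eq_empty.1 h1, disjoint_iff_inter_eq_empty.1 h2,
    union_empty, empty_union]

/-- Erasing e maps the sets containing e bijectively onto those avoiding it and divides the weight
by p/(1-p). The identity is cleared of denominators so that p = 1 is allowed. -/
theorem bernExp_toggle (he : e ∈ A) (φ : Finset α → ℝ) :
    (1 - p) * bernExp p A (fun T => if e ∈ T then φ (T.erase e) else 0) =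
      p * bernExp p A (fun T => if e ∈ T then 0 else φ T) := by
  have h : ∀ F : Finset α → ℝ, bernExp p A F = p * bernExp p (A.erase e)
      (fun T => F (insert e T)) + (1 - p) * bernExp p (A.erase e) F := fun F => by
    conv_lhs => rw [← insert_erase he]
    exact bernExp_insert (notMem_erase e A)
  have h1 : bernExp p (A.erase e) (fun T => if e ∈ T then φ (T.erase e) else 0) = 0 := by
    refine (bernExp_congr fun T hT => ?_).trans (bernExp_const (p := p) (A := A.erase e) 0)
    exact if_neg fun h => notMem_erase e A (hT h)
  have h2 : bernExp p (A.erase e) (fun T => if e ∈ T then 0 else φ T) =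
      bernExp p (A.erase e) φ :=
    bernExp_congr fun T hT => if_neg fun h => notMem_erase e A (hT h)
  have h3 : bernExp p (A.erase e) (fun T => φ ((insert e T).erase e)) =
      bernExp p (A.erase e) φ :=
    bernExp_congr fun T hT => by rw [erase_insert fun h => notMem_erase e A (hT h)]
  rw [h, h (fun T => if e ∈ T then 0 else φ T)]
  simp only [mem_insert_self, if_true, h1, h2, h3, bernExp_const]
  ring

theorem bernExp_mem (he : e ∈ A) : bernExp p A (fun T => if e ∈ T then 1 else 0) = p := by
  rw [← insert_erase he, bernExp_insert (notMem_erase e A)]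
  have h2 : bernExp p (A.erase e) (fun T => if e ∈ T then (1 : ℝ) else 0) = 0 := by
    refine (bernExp_congr fun T hT => ?_).trans (bernExp_const (p := p) (A := A.erase e) 0)
    exact if_neg fun h => notMem_erase e A (hT h)
  rw [h2]
  simp [bernExp_const]

theorem bernExp_card_inter (hB : B ⊆ A) : bernExp p A (fun T => (#(T ∩ B) : ℝ)) = p * #B := by
  have h : ∀ T : Finset α, (#(T ∩ B) : ℝ) = ∑ e ∈ B, if e ∈ T then (1 : ℝ) else 0 := fun T => by
    rw [sum_ite_mem, sum_const, nsmul_one, inter_comm]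
  simp only [h]
  rw [bernExp_sum, sum_congr rfl fun e he => bernExp_mem (hB he)]
  simp [mul_comm]

theorem bernExp_card : bernExp p A (fun T => (#T : ℝ)) = p * #A := by
  rw [← bernExp_card_inter (p := p) (subset_refl A)]
  exact bernExp_congr fun T hT => by rw [inter_eq_left.2 hT]

theorem bernExp_card_sq (A : Finset α) :
    bernExp p A (fun T => ((#T : ℝ) - p * #A) ^ 2) = p * (1 - p) * #A := by
  induction A using Finset.induction_on with
  | empty => simp [bernExp_empty]
  | insert a s ha ih =>
    rw [bernExp_insert ha, card_insert_of_notMem ha]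
    have h1 : bernExp p s (fun T => ((#(insert a T) : ℝ) - p * ((#s + 1 : ℕ) : ℝ)) ^ 2) =
        bernExp p s (fun T => ((#T : ℝ) - p * #s) ^ 2 + (2 * (1 - p) * ((#T : ℝ) - p * #s) +
          (1 - p) ^ 2)) := by
      refine bernExp_congr fun T hT => ?_
      rw [card_insert_of_notMem fun h => ha (hT h)]
      push_cast
      ring
    have h2 : bernExp p s (fun T => ((#T : ℝ) - p * ((#s + 1 : ℕ) : ℝ)) ^ 2) =
        bernExp p s (fun T => ((#T : ℝ) - p * #s) ^ 2 + (-2 * p * ((#T : ℝ) - p * #s) +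
          p ^ 2)) := by
      refine bernExp_congr fun T _ => ?_
      push_cast
      ring
    have h3 : bernExp p s (fun T => (#T : ℝ) - p * #s) = 0 := by
      rw [bernExp_sub, bernExp_card, bernExp_const, sub_self]
    rw [h1, h2, bernExp_add, bernExp_add, bernExp_add, bernExp_add, bernExp_const_mul,
      bernExp_const_mul, bernExp_const, bernExp_const, h3, ih]
    push_cast
    ring

/-- If removing `M` does not increase `F`, then avoiding `M` costs at least the probability
that no element of `M` is chosen. -/
theorem bernExp_avoid_le (h0 : 0 ≤ p) (h1 : p ≤ 1) (hM : M ⊆ A) (hF : ∀ T ⊆ A, F (T \ M) ≤ F T) :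
    bernExp p A (fun T => if Disjoint T M then F T else 0) ≤ (1 - p) ^ #M * bernExp p A F := by
  have key : bernExp p A (fun T => if Disjoint T M then F T else 0) =
      (1 - p) ^ #M * bernExp p (A \ M) F := by
    rw [← union_sdiff_of_subset hM, bernExp_union disjoint_sdiff]
    simp only [union_sdiff_of_subset hM]
    unfold bernExp
    rw [sum_eq_single ∅]
    · simp only [card_empty, pow_zero, sdiff_empty, one_mul]
      congr 1
      refine sum_congr rfl fun T hT => ?_
      rw [empty_union, if_pos]
      exact disjoint_of_subset_left (mem_powerset.1 hT) sdiff_disjoint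
    · intro S hS hne
      refine mul_eq_zero_of_right _ (sum_eq_zero fun T _ => mul_eq_zero_of_right _ (if_neg ?_))
      intro hd
      apply hne
      have := disjoint_of_subset_left subset_union_left hd
      exact (disjoint_self_iff_empty S).1 (this.mono_right (mem_powerset.1 hS))
    · simp
  rw [key]
  refine mul_le_mul_of_nonneg_left ?_ (pow_nonneg (by linarith) _)
  rw [← bernExp_inter sdiff_subset]
  refine bernExp_mono h0 h1 fun T hT => ?_
  refine le_trans (le_of_eq ?_) (hF T hT)
  congr 1
  ext x
  simp only [Finset.mem_inter, Finset.mem_sdiff]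
  exact ⟨fun h => ⟨h.1, h.2.2⟩, fun h => ⟨h.1, hT h.1, h.2⟩⟩

/-- The expectation depends only on the number of elements of the ground set, if the function
depends only on the number of chosen elements. -/
theorem bernExp_card_eq (g : ℕ → ℝ) (h : #A = #B) :
    bernExp p A (fun T => g #T) = bernExp p B (fun T => g #T) := by
  have key : ∀ C : Finset α, bernExp p C (fun T => g #T) =
      ∑ k ∈ range (#C + 1), (#C).choose k * (p ^ k * (1 - p) ^ (#C - k) * g k) := fun C => by
    have hs := sum_powerset_apply_card (fun k => p ^ k * (1 - p) ^ (#C - k) * g k) (x := C)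
    simp only [nsmul_eq_mul] at hs
    rw [← hs]
    exact sum_congr rfl fun T hT => by rw [card_sdiff_of_subset (mem_powerset.1 hT)]
  rw [key, key, h]

/-- `m p (1-p)^(m-1)` is the probability that a binomial variable equals one. -/
theorem mul_pow_pred_le_one (h0 : 0 ≤ p) (h1 : p ≤ 1) (m : ℕ) :
    (m : ℝ) * p * (1 - p) ^ (m - 1) ≤ 1 := by
  rcases m with _ | m
  · simp
  rw [Nat.add_sub_cancel]
  have hb := add_pow p (1 - p) (m + 1)
  rw [add_sub_cancel, one_pow] at hb
  refine le_trans (le_trans (le_of_eq ?_) (single_le_sum (f := fun k => p ^ k * (1 - p) ^ (m + 1 - k) *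
    ((m + 1).choose k : ℝ)) (fun k _ => ?_) (mem_range.2 (by omega : 1 < m + 1 + 1)))) hb.ge
  · simp
    ring
  · have : 0 ≤ 1 - p := by linarith
    positivity

end Bernoulli

/-! ### Reachability, degrees, components and bridges of finite edge sets -/

section EdgeSets

variable {V : Type*}

/-- Reachability in the graph with edge set `T`. -/
def Reach (T : Finset (Sym2 V)) (x y : V) : Prop :=
  (SimpleGraph.fromEdgeSet (T : Set (Sym2 V))).Reachable x y

variable {T T' : Finset (Sym2 V)} {x y z c d : V}

theorem Reach.refl (T : Finset (Sym2 V)) (x : V) : Reach T x x := SimpleGraph.Reachable.refl x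

theorem Reach.symm (h : Reach T x y) : Reach T y x := SimpleGraph.Reachable.symm h

theorem Reach.trans (h : Reach T x y) (h' : Reach T y z) : Reach T x z :=
  SimpleGraph.Reachable.trans h h'

theorem Reach.mono (hT : T ⊆ T') (h : Reach T x y) : Reach T' x y :=
  SimpleGraph.Reachable.mono (SimpleGraph.fromEdgeSet_mono (by exact_mod_cast hT)) h

theorem Reach.of_mem (h : s(x, y) ∈ T) : Reach T x y := by
  by_cases hxy : x = y
  · exact hxy ▸ Reach.refl T x
  · exact SimpleGraph.Adj.reachable ((SimpleGraph.fromEdgeSet_adj _).2 ⟨by exact_mod_cast h, hxy⟩)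

theorem Reach.rec_on {P : V → Prop} (h : Reach T x y) (hx : P x)
    (hs : ∀ a b, Reach T x a → P a → s(a, b) ∈ T → P b) : P y := by
  have h' := (SimpleGraph.reachable_iff_reflTransGen x y).1 h
  suffices Reach T x y ∧ P y from this.2
  induction h' with
  | refl => exact ⟨Reach.refl T x, hx⟩
  | @tail b c _ hbc ih =>
    have hm : s(b, c) ∈ T := by exact_mod_cast ((SimpleGraph.fromEdgeSet_adj _).1 hbc).1
    have hb : Reach T x b := by
      rename_i hxb
      exact (SimpleGraph.reachable_iff_reflTransGen x b).2 hxb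
    exact ⟨hb.trans (Reach.of_mem hm), hs b c hb (ih hb).2 hm⟩

/-- The edge `e` has no end in `Z`. -/
def Avoids (Z : Finset V) (e : Sym2 V) : Prop := ∀ z ∈ Z, z ∉ e

/-- The edges with no end in `Z`. -/
def avoiding (Z : Finset V) (T : Finset (Sym2 V)) : Finset (Sym2 V) := {e ∈ T | Avoids Z e}

/-- The edges with an end in `Z`. -/
def touching (Z : Finset V) (T : Finset (Sym2 V)) : Finset (Sym2 V) := {e ∈ T | ¬ Avoids Z e}

/-- No vertex of `Z` lies in the connected component of `c`. -/
def Unreached (T : Finset (Sym2 V)) (Z : Finset V) (c : V) : Prop := ∀ z ∈ Z, ¬ Reach T z c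

theorem reach_of_unreached {Z : Finset V} (hZ : Unreached T Z c) (h : Reach T c x) :
    Reach (avoiding Z T) c x := by
  refine h.rec_on (Reach.refl _ _) fun a b ha hP hab => hP.trans (Reach.of_mem ?_)
  refine mem_filter.2 ⟨hab, fun z hz hze => hZ z hz ?_⟩
  rcases Sym2.mem_iff.1 hze with rfl | rfl
  · exact ha.symm
  · exact (ha.trans (Reach.of_mem hab)).symm

variable [DecidableEq V]

theorem reach_erase_of_reach (hcd : Reach (T.erase s(c, d)) c d) (h : Reach T x y) :
    Reach (T.erase s(c, d)) x y := by
  refine h.rec_on (Reach.refl _ _) fun a b _ hP hab => hP.trans ?_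
  by_cases he : s(a, b) = s(c, d)
  · rcases Sym2.eq_iff.1 he with ⟨rfl, rfl⟩ | ⟨rfl, rfl⟩
    · exact hcd
    · exact hcd.symm
  · exact Reach.of_mem (mem_erase.2 ⟨he, hab⟩)

theorem reach_erase_iff (hcd : Reach (T.erase s(c, d)) c d) :
    Reach (T.erase s(c, d)) x y ↔ Reach T x y :=
  ⟨fun h => h.mono (erase_subset _ _), reach_erase_of_reach hcd⟩

/-- The number of edges at a vertex. -/
def edgeDeg (T : Finset (Sym2 V)) (x : V) : ℕ := #{e ∈ T | x ∈ e}

/-- Both ends of the edge `e` lie in `W`. -/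
def Inside (W : Finset V) (e : Sym2 V) : Prop := ∀ x ∈ e, x ∈ W

/-- The edges that lie inside a vertex set. -/
def within (W : Finset V) (T : Finset (Sym2 V)) : Finset (Sym2 V) := {e ∈ T | Inside W e}

/-- The edge `f` has an end in the connected component of `c`. -/
def InComp (T : Finset (Sym2 V)) (c : V) (f : Sym2 V) : Prop := ∃ x ∈ f, Reach T c x

/-- The number of edges in the connected component of a vertex. -/
def compSize (T : Finset (Sym2 V)) (c : V) : ℕ := #{f ∈ T | InComp T c f}

theorem within_subset (W : Finset V) (T : Finset (Sym2 V)) : within W T ⊆ T := filter_subset _ _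

theorem within_mono (W : Finset V) (h : T ⊆ T') : within W T ⊆ within W T' :=
  filter_subset_filter _ h

theorem mk_mem_within {W : Finset V} : s(x, y) ∈ within W T ↔ s(x, y) ∈ T ∧ x ∈ W ∧ y ∈ W := by
  rw [within, mem_filter, Inside, Sym2.ball]

theorem within_inter {W : Finset V} {E : Finset (Sym2 V)} (h : T ⊆ E) :
    T ∩ within W E = within W T := by
  ext e
  simp only [within, Finset.mem_inter, mem_filter]
  exact ⟨fun h => ⟨h.1, h.2.2⟩, fun h' => ⟨h'.1, h h'.1, h'.2⟩⟩

variable [Fintype V]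

theorem card_filter_mk_mem (T : Finset (Sym2 V)) (x : V) :
    #{y | s(x, y) ∈ T} = edgeDeg T x := by
  refine card_bij (fun y _ => s(x, y)) (fun y hy => ?_) (fun y _ y' _ h => ?_) fun e he => ?_
  · exact mem_filter.2 ⟨(mem_filter.1 hy).2, Sym2.mem_mk_left _ _⟩
  · exact Sym2.congr_right.1 h
  · obtain ⟨he, hx⟩ := mem_filter.1 he
    obtain ⟨y, rfl⟩ := hx
    exact ⟨y, by simpa using he, rfl⟩

theorem sum_mk_mem (T : Finset (Sym2 V)) (x : V) :
    ∑ y, (if s(x, y) ∈ T then (1 : ℝ) else 0) = edgeDeg T x := by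
  rw [← card_filter_mk_mem, sum_boole]

theorem card_filter_mem_sym2_le (e : Sym2 V) (P : V → Prop) : #{x | x ∈ e ∧ P x} ≤ 2 := by
  induction e with
  | _ a b =>
    refine le_trans (card_le_card (t := {a, b}) fun x hx => ?_) card_le_two
    simpa [Sym2.mem_iff] using (mem_filter.1 hx).2.1

theorem sum_edgeDeg_filter (T : Finset (Sym2 V)) (P : V → Prop) :
    ∑ x with P x, edgeDeg T x = ∑ e ∈ T, #{x | x ∈ e ∧ P x} := by
  simp only [edgeDeg, card_filter]
  rw [sum_comm]
  refine sum_congr rfl fun e _ => ?_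
  rw [sum_filter]
  refine sum_congr rfl fun x _ => ?_
  by_cases h1 : P x <;> by_cases h2 : x ∈ e <;> simp [h1, h2]

theorem sum_edgeDeg_le (T : Finset (Sym2 V)) : ∑ x, edgeDeg T x ≤ 2 * #T := by
  have h := sum_edgeDeg_filter T (fun _ => True)
  rw [filter_true] at h
  rw [h, mul_comm, ← smul_eq_mul]
  exact sum_le_card_nsmul _ _ _ fun e _ => card_filter_mem_sym2_le e _

theorem card_le_sum_edgeDeg (T : Finset (Sym2 V)) : #T ≤ ∑ x, edgeDeg T x := by
  have h := sum_edgeDeg_filter T (fun _ => True)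
  rw [filter_true] at h
  rw [h, card_eq_sum_ones]
  refine sum_le_sum fun e _ => ?_
  induction e with
  | _ a b => exact card_pos.2 ⟨a, by simp⟩

theorem sum_edgeDeg_reach_le (T : Finset (Sym2 V)) (c : V) :
    ∑ x with Reach T c x, edgeDeg T x ≤ 2 * compSize T c := by
  rw [sum_edgeDeg_filter, compSize, mul_comm, ← smul_eq_mul]
  rw [← sum_filter_add_sum_filter_not T (InComp T c)]
  rw [sum_eq_zero (s := {f ∈ T | ¬ InComp T c f}), add_zero]
  · exact sum_le_card_nsmul _ _ _ fun e _ => card_filter_mem_sym2_le e _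
  · intro e he
    rw [card_eq_zero, filter_eq_empty_iff]
    exact fun x _ hx => (mem_filter.1 he).2 ⟨x, hx.1, hx.2⟩

theorem compSize_le_sum_edgeDeg_reach (T : Finset (Sym2 V)) (c : V) :
    compSize T c ≤ ∑ x with Reach T c x, edgeDeg T x := by
  rw [sum_edgeDeg_filter, compSize, card_filter]
  refine sum_le_sum fun e _ => ?_
  split_ifs with h
  · obtain ⟨x, hx, hr⟩ := h
    exact card_pos.2 ⟨x, by simp [hx, hr]⟩
  · exact Nat.zero_le _

theorem compSize_congr (h : Reach T x y) : compSize T x = compSize T y := by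
  unfold compSize
  congr 1
  refine filter_congr fun f _ => ?_
  exact ⟨fun ⟨a, ha, hr⟩ => ⟨a, ha, h.symm.trans hr⟩, fun ⟨a, ha, hr⟩ => ⟨a, ha, h.trans hr⟩⟩

/-- Deleting a non-bridge loses only that edge; this is the source of the denominator β - 1 in the
bounds for large components. -/
theorem compSize_erase (hcd : Reach (T.erase s(c, d)) c d) :
    compSize T c ≤ compSize (T.erase s(c, d)) c + 1 := by
  unfold compSize
  refine le_trans (card_le_card (t := insert s(c, d)
    {f ∈ T.erase s(c, d) | InComp (T.erase s(c, d)) c f}) fun f hf => ?_)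
    (card_insert_le _ _)
  obtain ⟨hf, x, hx, hr⟩ := mem_filter.1 hf
  by_cases he : f = s(c, d)
  · exact mem_insert.2 (Or.inl he)
  · exact mem_insert.2 (Or.inr (mem_filter.2 ⟨mem_erase.2 ⟨he, hf⟩, x, hx,
      reach_erase_of_reach hcd hr⟩))

/-- A finite forest has at most as many edges as vertices. -/
theorem card_edgeFinset_le_of_isAcyclic {U : Type*} [Fintype U] {F : SimpleGraph U}
    (hF : F.IsAcyclic) : #F.edgeFinset ≤ Fintype.card U := by
  rcases isEmpty_or_nonempty U with h | h
  · simp [Subsingleton.elim F ⊥]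
  · obtain ⟨S, hFS, -, hS⟩ := (SimpleGraph.connected_top (V := U)).exists_isTree_le_of_le_of_isAcyclic
      le_top hF
    have := hS.card_edgeFinset
    have h2 := card_le_card (SimpleGraph.edgeFinset_mono hFS)
    omega

/-- A graph has at most `2 |W|` oriented bridges if all its edges lie inside `W`. -/
theorem card_bridges_le {W : Finset V} (hW : within W T = T) :
    #{q : V × V | s(q.1, q.2) ∈ T ∧ ¬ Reach (T.erase s(q.1, q.2)) q.1 q.2} ≤ 2 * #W := by
  let F : SimpleGraph W :=
    { Adj := fun x y => s((x : V), (y : V)) ∈ T ∧ ¬ Reach (T.erase s((x : V), (y : V))) x y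
      symm := ⟨fun x y h => by
        rw [Sym2.eq_swap]
        exact ⟨h.1, fun h' => h.2 h'.symm⟩⟩
      loopless := ⟨fun x h => h.2 (Reach.refl _ _)⟩ }
  -- The edges of F are bridges of the graph with edge set T, hence also of its subgraph F; a graph
  -- all of whose edges are bridges is a forest.
  have hF : F.IsAcyclic := by
    rw [SimpleGraph.isAcyclic_iff_forall_adj_isBridge]
    intro x y hxy
    rw [SimpleGraph.isBridge_iff]
    intro hr
    apply hxy.2
    have hgen := (SimpleGraph.reachable_iff_reflTransGen x y).1 hr
    clear hr
    suffices ∀ w : W, Relation.ReflTransGen (F.deleteEdges {s(x, y)}).Adj x w →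
        Reach (T.erase s((x : V), (y : V))) x w from this y hgen
    intro w hw
    induction hw with
    | refl => exact Reach.refl _ _
    | @tail a b _ hab ih =>
      refine ih.trans (Reach.of_mem (mem_erase.2 ⟨fun he => ?_, ?_⟩))
      · have h2 := (SimpleGraph.deleteEdges_adj.1 hab).2
        apply h2
        rw [Set.mem_singleton_iff]
        rcases Sym2.eq_iff.1 he with ⟨h, h'⟩ | ⟨h, h'⟩
        · exact Sym2.eq_iff.2 (Or.inl ⟨Subtype.ext h, Subtype.ext h'⟩)
        · exact Sym2.eq_iff.2 (Or.inr ⟨Subtype.ext h, Subtype.ext h'⟩)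
      · exact (SimpleGraph.deleteEdges_adj.1 hab).1.1
  have hcard := card_edgeFinset_le_of_isAcyclic hF
  rw [Fintype.card_coe] at hcard
  refine le_trans ?_ (Nat.mul_le_mul_left 2 hcard)
  rw [SimpleGraph.two_mul_card_edgeFinset]
  refine card_le_card_of_surjOn (fun q : W × W => ((q.1 : V), (q.2 : V))) ?_
  rintro ⟨a, b⟩ hq
  have hq' := (mem_filter.1 (mem_coe.1 hq)).2
  have hm : s(a, b) ∈ within W T := hW.symm ▸ hq'.1
  obtain ⟨-, ha, hb⟩ := mk_mem_within.1 hm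
  exact ⟨(⟨a, ha⟩, ⟨b, hb⟩), by simpa [F] using hq', rfl⟩

theorem sum_bridges_le {W : Finset V} (hW : within W T = T) :
    ∑ x, ∑ y, (if s(x, y) ∈ T ∧ ¬ Reach (T.erase s(x, y)) x y then (1 : ℝ) else 0) ≤ 2 * #W := by
  rw [← Fintype.sum_prod_type' (f := fun x y =>
    if s(x, y) ∈ T ∧ ¬ Reach (T.erase s(x, y)) x y then (1 : ℝ) else 0), sum_boole]
  exact_mod_cast card_bridges_le hW

end EdgeSets

/-! ### Cost of a component avoiding the neighbours of a vertex -/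

section Blocking

variable {V : Type*} [DecidableEq V] [Fintype V]
variable {p : ℝ} {A T : Finset (Sym2 V)} {W N : Finset V} {c d : V}

/-- The number of vertices of `N` in the connected component of a vertex. -/
def compCount (N : Finset V) (T : Finset (Sym2 V)) (c : V) : ℕ := #{y ∈ N | Reach T c y}

theorem compCount_congr {x y : V} (h : Reach T x y) : compCount N T x = compCount N T y := by
  unfold compCount
  congr 1
  exact filter_congr fun z _ => ⟨fun h' => h.symm.trans h', fun h' => h.trans h'⟩

theorem compCount_pos (hc : c ∈ N) : 0 < compCount N T c :=
  card_pos.2 ⟨c, mem_filter.2 ⟨hc, Reach.refl _ _⟩⟩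

theorem compCount_erase (hcd : Reach (T.erase s(c, d)) c d) (x : V) :
    compCount N (T.erase s(c, d)) x = compCount N T x := by
  unfold compCount
  congr 1
  exact filter_congr fun z _ => reach_erase_iff hcd

/-- Bridges are bounded by their indicator. A non-bridge cd is deleted by `bernExp_toggle`: the
component of c keeps its vertices, one factor 1-p is exchanged for p, and the weight θ' is replaced
by a weight θ that dominates it after the deletion. What remains concerns pairs c, d in one
component instead of edges. -/
theorem bernExp_edge_le (h0 : 0 ≤ p) (h1 : p ≤ 1) (hc : c ∈ N) (hcd : s(c, d) ∈ A)
    (θ θ' : Finset (Sym2 V) → ℝ) (hθ0 : ∀ T, 0 ≤ θ T) (hθ1 : ∀ T, θ' T ≤ 1)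
    (hθ : ∀ T, s(c, d) ∈ T → Reach (T.erase s(c, d)) c d → θ' T ≤ θ (T.erase s(c, d))) :
    bernExp p A (fun T => if s(c, d) ∈ T then (1 - p) ^ compCount N T c * θ' T else 0) ≤
      bernExp p A (fun T => if s(c, d) ∈ T ∧ ¬ Reach (T.erase s(c, d)) c d then 1 else 0) +
      bernExp p A (fun T => if Reach T c d then
        p * (1 - p) ^ (compCount N T c - 1) * θ T else 0) := by
  have hp : 0 ≤ 1 - p := by linarith
  let φ : Finset (Sym2 V) → ℝ := fun T => if Reach T c d then
    (1 - p) ^ (compCount N T c - 1) * θ T else 0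
  have hφ0 : ∀ T, 0 ≤ φ T := fun T => by
    simp only [φ]
    split_ifs
    · exact mul_nonneg (pow_nonneg hp _) (hθ0 T)
    · exact le_rfl
  have key : bernExp p A (fun T => if s(c, d) ∈ T then (1 - p) ^ compCount N T c * θ' T else 0) ≤
      bernExp p A (fun T => (if s(c, d) ∈ T ∧ ¬ Reach (T.erase s(c, d)) c d then 1 else 0) +
        (1 - p) * if s(c, d) ∈ T then φ (T.erase s(c, d)) else 0) := by
    refine bernExp_mono h0 h1 fun T _ => ?_
    by_cases hT : s(c, d) ∈ T
    · by_cases hr : Reach (T.erase s(c, d)) c d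
      · simp only [hT, hr, if_true, not_true, and_false, if_false, zero_add, φ,
          compCount_erase hr]
        -- The exponent is positive because c itself belongs to N, so a factor 1-p can be split off.
        rw [← mul_assoc, ← pow_succ', Nat.sub_add_cancel (compCount_pos hc)]
        exact mul_le_mul_of_nonneg_left (hθ T hT hr) (pow_nonneg hp _)
      · simp only [hT, hr, if_true, not_false_iff, and_true]
        have h2 : (1 - p) ^ compCount N T c * θ' T ≤ 1 :=
          le_trans (mul_le_mul_of_nonneg_left (hθ1 T) (pow_nonneg hp _))
            (by rw [mul_one]; exact pow_le_one₀ hp (by linarith))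
        exact le_trans h2 (le_add_of_nonneg_right (mul_nonneg hp (hφ0 _)))
    · simp [hT]
  refine key.trans ?_
  rw [bernExp_add, bernExp_const_mul, bernExp_toggle hcd, ← bernExp_const_mul]
  refine add_le_add le_rfl (bernExp_mono h0 h1 fun T _ => ?_)
  by_cases hT : s(c, d) ∈ T
  · simp only [hT, if_true, mul_zero]
    have := mul_nonneg h0 (hφ0 T)
    simp only [φ, mul_ite, mul_zero] at this
    rwa [← mul_assoc] at this
  · simp only [hT, if_false, φ, mul_ite, mul_zero]
    rw [← mul_assoc]

theorem sum_sum_bernExp_edge_le (h0 : 0 ≤ p) (h1 : p ≤ 1) (hA : within W A = A)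
    (D : V → Finset V) (θ θ' : V → V → Finset (Sym2 V) → ℝ) (hθ0 : ∀ c d T, 0 ≤ θ c d T)
    (hθ1 : ∀ c d T, θ' c d T ≤ 1)
    (hθ : ∀ c d T, s(c, d) ∈ T → Reach (T.erase s(c, d)) c d →
      θ' c d T ≤ θ c d (T.erase s(c, d))) :
    bernExp p A (fun T => ∑ c ∈ N, ∑ d ∈ D c, if s(c, d) ∈ T then
        (1 - p) ^ compCount N T c * θ' c d T else 0) ≤
      2 * #W + bernExp p A (fun T => ∑ c ∈ N, ∑ d ∈ D c, if s(c, d) ∈ A ∧ Reach T c d then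
        p * (1 - p) ^ (compCount N T c - 1) * θ c d T else 0) := by
  have hb : bernExp p A (fun T => ∑ c ∈ N, ∑ d ∈ D c,
      if s(c, d) ∈ T ∧ ¬ Reach (T.erase s(c, d)) c d then (1 : ℝ) else 0) ≤ 2 * #W := by
    rw [← bernExp_const (p := p) (A := A) (2 * #W : ℝ)]
    refine bernExp_mono h0 h1 fun T hT => ?_
    have hWT : within W T = T := by
      rw [← within_inter hT, hA, inter_eq_left.2 hT]
    have hn : ∀ c d : V, (0 : ℝ) ≤
        if s(c, d) ∈ T ∧ ¬ Reach (T.erase s(c, d)) c d then (1 : ℝ) else 0 := fun c d => by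
      split_ifs <;> norm_num
    refine le_trans ?_ (sum_bridges_le hWT)
    refine le_trans (sum_le_sum fun c _ => sum_le_sum_of_subset_of_nonneg (subset_univ _)
      fun d _ _ => hn c d) ?_
    exact sum_le_sum_of_subset_of_nonneg (subset_univ _) fun c _ _ =>
      sum_nonneg fun d _ => hn c d
  refine le_trans ?_ (add_le_add hb le_rfl)
  rw [← bernExp_add]
  simp only [← sum_add_distrib]
  simp only [bernExp_sum]
  refine sum_le_sum fun c hc => sum_le_sum fun d _ => ?_
  by_cases hcd : s(c, d) ∈ A
  · simp only [hcd, true_and]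
    rw [bernExp_add]
    exact bernExp_edge_le h0 h1 hc hcd _ _ (hθ0 c d) (hθ1 c d) (hθ c d)
  · refine bernExp_mono h0 h1 fun T hT => ?_
    simp [hcd, show s(c, d) ∉ T from fun h => hcd (hT h)]

/-- The weighted number of edges with both ends in `N`. -/
theorem bernExp_sum_edges_inside_le (h0 : 0 ≤ p) (h1 : p ≤ 1) (hA : within W A = A)
    (hN : N ⊆ W) :
    bernExp p A (fun T => ∑ c ∈ N, ∑ d ∈ N, if s(c, d) ∈ T then
      (1 - p) ^ compCount N T c * 1 else 0) ≤ 3 * #W := by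
  have hp : 0 ≤ 1 - p := by linarith
  have h := sum_sum_bernExp_edge_le (N := N) h0 h1 hA (fun _ => N) (fun _ _ _ => 1)
    (fun _ _ _ => 1) (fun _ _ _ => zero_le_one) (fun _ _ _ => le_rfl) (fun _ _ _ _ _ => le_rfl)
  refine h.trans ?_
  have h2 : bernExp p A (fun T => ∑ c ∈ N, ∑ d ∈ N, if s(c, d) ∈ A ∧ Reach T c d then
      p * (1 - p) ^ (compCount N T c - 1) * 1 else 0) ≤ #W := by
    rw [← bernExp_const (p := p) (A := A) (#W : ℝ)]
    refine bernExp_mono h0 h1 fun T _ => ?_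
    have h3 : (#W : ℝ) ≥ ∑ c ∈ N, (1 : ℝ) := by
      simp only [sum_const, nsmul_one]
      exact_mod_cast card_le_card hN
    refine le_trans (sum_le_sum fun c _ => ?_) h3
    refine le_trans (sum_le_sum (g := fun d => if Reach T c d then
      p * (1 - p) ^ (compCount N T c - 1) else 0) fun d _ => ?_) ?_
    · have : 0 ≤ p * (1 - p) ^ (compCount N T c - 1) := by positivity
      split_ifs with h4 h5 h5
      · rw [mul_one]
      · exact absurd h4.2 h5
      · exact this
      · exact le_rfl
    -- With m vertices of N in the component of c, there are m choices of d, and m p (1-p)^(m-1) ≤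
    -- 1.
    · rw [← sum_filter, sum_const, nsmul_eq_mul, ← mul_assoc]
      exact mul_pow_pred_le_one h0 h1 _
  linarith

/-- Double counting: an edge f is counted once for each of the m vertices of N in its component,
each time with weight p (1-p)^(m-1), so at most once in total. -/
theorem sum_compSize_le (h0 : 0 ≤ p) (h1 : p ≤ 1) (T : Finset (Sym2 V)) (N : Finset V) :
    ∑ c ∈ N, p * (1 - p) ^ (compCount N T c - 1) * compSize T c ≤ #T := by
  have h : ∀ c, (compSize T c : ℝ) = ∑ f ∈ T, if InComp T c f then (1 : ℝ) else 0 := fun c => by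
    rw [sum_boole, compSize]
  simp only [h, mul_sum]
  rw [sum_comm, ← nsmul_one (#T), ← sum_const]
  refine sum_le_sum fun f hf => ?_
  induction f with
  | _ a b =>
    have hab : Reach T a b := Reach.of_mem hf
    have hin : ∀ c, InComp T c s(a, b) ↔ Reach T a c := fun c => by
      constructor
      · rintro ⟨x, hx, hr⟩
        rcases Sym2.mem_iff.1 hx with rfl | rfl
        · exact hr.symm
        · exact hab.trans hr.symm
      · exact fun hr => ⟨a, Sym2.mem_mk_left _ _, hr.symm⟩
    simp only [hin, mul_ite, mul_one, mul_zero]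
    rw [← sum_filter, sum_congr rfl (g := fun _ => p * (1 - p) ^ (compCount N T a - 1)),
      sum_const, nsmul_eq_mul, ← mul_assoc]
    · exact mul_pow_pred_le_one h0 h1 _
    · intro c hc
      rw [compCount_congr (mem_filter.1 hc).2]

/-- The weighted number of edges at `N` in large components. -/
theorem bernExp_sum_edges_large_le (h0 : 0 ≤ p) (h1 : p ≤ 1) (hA : within W A = A)
    {β : ℝ} (hβ : 1 < β) :
    bernExp p A (fun T => ∑ c ∈ N, ∑ d, if s(c, d) ∈ T then
      (1 - p) ^ compCount N T c * (if β ≤ compSize T c then 1 else 0) else 0) ≤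
      2 * #W + #W * (p * #A) / (β - 1) := by
  have hp : 0 ≤ 1 - p := by linarith
  have hβ' : 0 < β - 1 := by linarith
  -- Here d ranges over all vertices, so the pair count alone would be too large. The indicator of
  -- size at least β is therefore replaced, Markov style, by size/(β-1) after the deletion. Only the
  -- |W| vertices d in W contribute, and the sizes are summed by `sum_compSize_le`.
  have h := sum_sum_bernExp_edge_le (N := N) h0 h1 hA (fun _ => univ)
    (fun c _ T => compSize T c / (β - 1)) (fun c _ T => if β ≤ compSize T c then 1 else 0)
    (fun _ _ _ => by positivity) (fun _ _ _ => by split_ifs <;> norm_num) (fun c d T _ hr => by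
      have h2 : (compSize T c : ℝ) ≤ compSize (T.erase s(c, d)) c + 1 := by
        exact_mod_cast compSize_erase hr
      split_ifs with h3
      · rw [one_le_div hβ']
        linarith
      · positivity)
  refine h.trans (add_le_add le_rfl ?_)
  rw [mul_div_assoc, ← bernExp_card (p := p) (A := A), div_eq_mul_inv, ← bernExp_mul_const,
    ← bernExp_const_mul]
  refine bernExp_mono h0 h1 fun T _ => ?_
  rw [← mul_assoc, ← div_eq_mul_inv, le_div_iff₀ hβ', sum_mul]
  refine le_trans (sum_le_sum (g := fun c => #W * (p * (1 - p) ^ (compCount N T c - 1) *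
    compSize T c)) fun c _ => ?_) ?_
  · rw [sum_mul]
    have hx : 0 ≤ p * (1 - p) ^ (compCount N T c - 1) * (compSize T c) := by positivity
    refine le_trans (sum_le_sum (g := fun d => if d ∈ W then
      p * (1 - p) ^ (compCount N T c - 1) * compSize T c else 0) fun d _ => ?_) ?_
    · by_cases hcd : s(c, d) ∈ A ∧ Reach T c d
      · rw [if_pos hcd, if_pos (mk_mem_within.1 (hA.symm ▸ hcd.1)).2.2]
        rw [mul_assoc, div_mul_cancel₀ _ hβ'.ne']
      · rw [if_neg hcd, zero_mul]
        split_ifs <;> [exact hx; exact le_rfl]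
    · rw [sum_ite_mem, univ_inter, sum_const, nsmul_eq_mul]
  · rw [← mul_sum]
    exact mul_le_mul_of_nonneg_left (sum_compSize_le h0 h1 T N) (Nat.cast_nonneg _)

theorem touching_subset (Z : Finset V) (T : Finset (Sym2 V)) : touching Z T ⊆ T :=
  filter_subset _ _

theorem avoiding_subset (Z : Finset V) (T : Finset (Sym2 V)) : avoiding Z T ⊆ T :=
  filter_subset _ _

theorem disjoint_touching_avoiding (Z : Finset V) (T T' : Finset (Sym2 V)) :
    Disjoint (touching Z T) (avoiding Z T') := by
  refine disjoint_left.2 fun e he he' => ?_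
  exact (mem_filter.1 he).2 (mem_filter.1 he').2

/-- The neighbours of `x` in `W`, outside of `Z`. -/
def outNbrs (W Z : Finset V) (E : Finset (Sym2 V)) (x : V) : Finset V :=
  {y ∈ W | y ∉ Z ∧ s(x, y) ∈ E}

/-- Edges `cd` of the percolated graph whose component is not joined to `x` although `c` is a
neighbour of `x` in the host graph: the edges at `Z` may be integrated out. -/
theorem bernExp_unreached_le (h0 : 0 ≤ p) (h1 : p ≤ 1) (E : Finset (Sym2 V)) (W Z : Finset V)
    {x : V} (hx : x ∈ Z) (f : Finset (Sym2 V) → ℝ) (hf0 : ∀ T, 0 ≤ f T)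
    (hf : ∀ T, ∀ M ⊆ (outNbrs W Z E x).image (fun y => s(x, y)), f (T \ M) ≤ f T)
    (D : Finset V) (Θ : V → V → Finset (Sym2 V) → ℝ) (hΘ : ∀ c d T, 0 ≤ Θ c d T) :
    bernExp p E (fun T => f (T ∩ touching Z E) * ∑ c ∈ outNbrs W Z E x, ∑ d ∈ D,
        if s(c, d) ∈ within W T ∧ Unreached T Z c then
          Θ c d (T ∩ within W (avoiding Z E)) else 0) ≤
      bernExp p (touching Z E) f * bernExp p (within W (avoiding Z E)) (fun T =>
        ∑ c ∈ outNbrs W Z E x, ∑ d ∈ D, if s(c, d) ∈ T then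
          (1 - p) ^ compCount (outNbrs W Z E x) T c * Θ c d T else 0) := by
  have hp : 0 ≤ 1 - p := by linarith
  set N := outNbrs W Z E x with hN
  set E1 := touching Z E with hE1
  set E0 := within W (avoiding Z E) with hE0
  -- The host edges from x to its neighbours in the component of c. All of them must be absent from
  -- T if c is not joined to x. Given the edges away from Z this is an event about the edges at Z
  -- only, and `bernExp_avoid_le` bounds f on it by (1-p)^m times its mean.
  let M : Finset (Sym2 V) → V → Finset (Sym2 V) := fun T c =>
    ({y ∈ N | Reach T c y}).image (fun y => s(x, y))
  have hdis : Disjoint E0 E1 :=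
    (disjoint_of_subset_right (within_subset _ _) (disjoint_touching_avoiding Z E E)).symm
  have hsub : E0 ∪ E1 ⊆ E :=
    union_subset ((within_subset _ _).trans (avoiding_subset _ _)) (touching_subset _ _)
  let G : Finset (Sym2 V) → Finset (Sym2 V) → ℝ := fun T0 T1 => ∑ c ∈ N, ∑ d ∈ D,
    if s(c, d) ∈ T0 then (if Disjoint T1 (M T0 c) then f T1 else 0) * Θ c d T0 else 0
  have step1 : ∀ T ⊆ E, (f (T ∩ E1) * ∑ c ∈ N, ∑ d ∈ D,
      if s(c, d) ∈ within W T ∧ Unreached T Z c then Θ c d (T ∩ E0) else 0) ≤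
      G (T ∩ (E0 ∪ E1) ∩ E0) (T ∩ (E0 ∪ E1) ∩ E1) := by
    intro T hT
    rw [inter_assoc, inter_assoc, inter_eq_right.2 subset_union_left,
      inter_eq_right.2 subset_union_right, mul_sum]
    refine sum_le_sum fun c _ => ?_
    rw [mul_sum]
    refine sum_le_sum fun d _ => ?_
    split_ifs with h2 h3 h4 h4
    · exact le_rfl
    · exfalso
      apply h4
      refine disjoint_left.2 fun e he he' => ?_
      obtain ⟨y, hy, rfl⟩ := mem_image.1 he'
      have hxy := Reach.of_mem (Finset.mem_inter.1 he).1
      exact h2.2 x hx (hxy.trans (((mem_filter.1 hy).2.mono Finset.inter_subset_left).symm))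
    · exfalso
      apply h3
      obtain ⟨hm, hc, hd⟩ := mk_mem_within.1 h2.1
      refine Finset.mem_inter.2 ⟨hm, mk_mem_within.2 ⟨mem_filter.2 ⟨hT hm, fun z hz hze => ?_⟩,
        hc, hd⟩⟩
      rcases Sym2.mem_iff.1 hze with rfl | rfl
      · exact h2.2 _ hz (Reach.refl _ _)
      · exact h2.2 _ hz (Reach.of_mem hm).symm
    · rw [mul_zero]
      exact mul_nonneg (hf0 _) (hΘ _ _ _)
    · rw [mul_zero, zero_mul]
    · rw [mul_zero]
  refine (bernExp_mono h0 h1 step1).trans ?_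
  rw [bernExp_inter hsub (fun T => G (T ∩ E0) (T ∩ E1)), bernExp_union hdis, mul_comm,
    ← bernExp_mul_const]
  refine bernExp_mono h0 h1 fun T0 hT0 => ?_
  have hcg : bernExp p E1 (fun T1 => G ((T0 ∪ T1) ∩ E0) ((T0 ∪ T1) ∩ E1)) =
      bernExp p E1 (fun T1 => G T0 T1) := by
    refine bernExp_congr fun T1 hT1 => ?_
    have d1 : Disjoint T1 E0 := disjoint_of_subset_left hT1 hdis.symm
    have d2 : Disjoint T0 E1 := disjoint_of_subset_left hT0 hdis
    rw [union_inter_distrib_right, union_inter_distrib_right, inter_eq_left.2 hT0,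
      inter_eq_left.2 hT1, disjoint_iff_inter_eq_empty.1 d1, disjoint_iff_inter_eq_empty.1 d2,
      union_empty, empty_union]
  rw [hcg]
  simp only [G]
  rw [bernExp_sum, sum_mul]
  refine sum_le_sum fun c hc => ?_
  rw [bernExp_sum, sum_mul]
  refine sum_le_sum fun d _ => ?_
  by_cases hcd : s(c, d) ∈ T0
  · simp only [hcd, if_true]
    rw [bernExp_mul_const]
    have hMN : M T0 c ⊆ N.image (fun y => s(x, y)) := image_subset_image (filter_subset _ _)
    have hM1 : M T0 c ⊆ E1 := fun e he => by
      obtain ⟨y, hy, rfl⟩ := mem_image.1 he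
      exact mem_filter.2 ⟨(mem_filter.1 (mem_filter.1 hy).1).2.2,
        fun h => h x hx (Sym2.mem_mk_left _ _)⟩
    have hcard : #(M T0 c) = compCount N T0 c :=
      card_image_of_injective _ fun a b hab => Sym2.congr_right.1 hab
    have := bernExp_avoid_le h0 h1 hM1 (F := f) fun T _ => hf T _ hMN
    rw [hcard] at this
    calc _ ≤ ((1 - p) ^ compCount N T0 c * bernExp p E1 f) * Θ c d T0 :=
          mul_le_mul_of_nonneg_right this (hΘ _ _ _)
      _ = _ := by ring
  · simp [hcd, bernExp_const]

end Blocking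

/-! ### Switchings and the joint law of host graph and percolation -/

section Switching

variable {V : Type*} [DecidableEq V] [Fintype V]

/-- The edge sets of the simple graphs with a given degree sequence. -/
def edgeSets (D : V → ℕ) : Finset (Finset (Sym2 V)) :=
  {E | (∀ e ∈ E, ¬ e.IsDiag) ∧ ∀ x, edgeDeg E x = D x}

/-- The sum over all realizations `E` of a degree sequence of the expectation of `F E T` for the
percolated edge set `T` of `E`. -/
def totalExp (p : ℝ) (D : V → ℕ) (F : Finset (Sym2 V) → Finset (Sym2 V) → ℝ) : ℝ :=
  ∑ E ∈ edgeSets D, bernExp p E (F E)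

variable {p : ℝ} {D : V → ℕ} {E T : Finset (Sym2 V)} {v b c d : V}
variable {F F' : Finset (Sym2 V) → Finset (Sym2 V) → ℝ}

theorem ne_of_mem_edgeSets (hE : E ∈ edgeSets D) {x y : V} (h : s(x, y) ∈ E) : x ≠ y :=
  (mem_filter.1 hE).2.1 _ h

theorem totalExp_mono (h0 : 0 ≤ p) (h1 : p ≤ 1)
    (h : ∀ E ∈ edgeSets D, ∀ T ⊆ E, F E T ≤ F' E T) : totalExp p D F ≤ totalExp p D F' :=
  sum_le_sum fun E hE => bernExp_mono h0 h1 (h E hE)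

theorem totalExp_le_of_forall {K : ℝ} (h : ∀ E ∈ edgeSets D, bernExp p E (F E) ≤ K) :
    totalExp p D F ≤ #(edgeSets D) * K := by
  rw [← nsmul_eq_mul]
  exact sum_le_card_nsmul _ _ _ h

theorem totalExp_add : totalExp p D (fun E T => F E T + F' E T) =
    totalExp p D F + totalExp p D F' := by
  unfold totalExp
  rw [← sum_add_distrib]
  exact sum_congr rfl fun E _ => bernExp_add

theorem totalExp_const_mul (a : ℝ) : totalExp p D (fun E T => a * F E T) =
    a * totalExp p D F := by
  unfold totalExp
  rw [mul_sum]
  exact sum_congr rfl fun E _ => bernExp_const_mul a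

theorem totalExp_sum {ι : Type*} (s : Finset ι)
    (f : ι → Finset (Sym2 V) → Finset (Sym2 V) → ℝ) :
    totalExp p D (fun E T => ∑ i ∈ s, f i E T) = ∑ i ∈ s, totalExp p D (f i) := by
  unfold totalExp
  rw [sum_comm]
  exact sum_congr rfl fun E _ => bernExp_sum s fun i => f i E

/-- Replace the edges `vb` and `cd` by `vc` and `bd`. -/
def switch (v b c d : V) (T : Finset (Sym2 V)) : Finset (Sym2 V) :=
  insert s(v, c) (insert s(b, d) (T \ {s(v, b), s(c, d)}))

theorem edgeDeg_insert {e : Sym2 V} (he : e ∉ T) (x : V) :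
    edgeDeg (insert e T) x = edgeDeg T x + if x ∈ e then 1 else 0 := by
  unfold edgeDeg
  rw [filter_insert]
  split_ifs with h
  · exact card_insert_of_notMem fun h' => he (mem_filter.1 h').1
  · rfl

/-- The switch is possible in `T`, whose graph is loopless. -/
structure Switchable (v b c d : V) (T : Finset (Sym2 V)) : Prop where
  vb : s(v, b) ∈ T
  cd : s(c, d) ∈ T
  vc : s(v, c) ∉ T
  bd : s(b, d) ∉ T
  hvb : v ≠ b
  hcd : c ≠ d
  hvc : v ≠ c
  hbd : b ≠ d

namespace Switchable

theorem hvd (h : Switchable v b c d T) : v ≠ d := by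
  rintro rfl
  exact h.vc (Sym2.eq_swap ▸ h.cd)

theorem vb_ne_cd (h : Switchable v b c d T) : s(v, b) ≠ s(c, d) := by
  have := h.hvc
  have := h.hvd
  simp [*]

theorem vc_ne_bd (h : Switchable v b c d T) : s(v, c) ≠ s(b, d) := by
  have := h.hvb
  have := h.hvd
  simp [*]

theorem eq_insert (h : Switchable v b c d T) :
    T = insert s(v, b) (insert s(c, d) (T \ {s(v, b), s(c, d)})) := by
  have h1 := h.vb
  have h2 := h.cd
  generalize s(v, b) = e1, s(c, d) = e2 at *
  grind

theorem switch_switch (h : Switchable v b c d T) :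
    switch v c b d (switch v b c d T) = T := by
  have h1 := h.vb
  have h2 := h.cd
  have h3 := h.vc
  have h4 := h.bd
  unfold switch
  generalize s(v, b) = e1, s(c, d) = e2, s(v, c) = e3, s(b, d) = e4 at *
  ext e
  simp only [Finset.mem_insert, Finset.mem_sdiff, Finset.mem_singleton]
  by_cases x1 : e = e1 <;> by_cases x2 : e = e2 <;> by_cases x3 : e = e3 <;>
    by_cases x4 : e = e4 <;> simp_all

theorem card_switch (h : Switchable v b c d T) : #(switch v b c d T) = #T := by
  conv_rhs => rw [h.eq_insert]
  have h3 := h.vc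
  have h4 := h.bd
  have h5 := h.vb_ne_cd
  have h6 := h.vc_ne_bd
  rw [switch, card_insert_of_notMem, card_insert_of_notMem, card_insert_of_notMem,
    card_insert_of_notMem] <;> simp [*]

theorem edgeDeg_switch (h : Switchable v b c d T) (x : V) :
    edgeDeg (switch v b c d T) x = edgeDeg T x := by
  conv_rhs => rw [h.eq_insert]
  have h3 := h.vc
  have h4 := h.bd
  have h5 := h.vb_ne_cd
  have h6 := h.vc_ne_bd
  rw [switch, edgeDeg_insert, edgeDeg_insert, edgeDeg_insert, edgeDeg_insert]
  · simp only [Sym2.mem_iff]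
    have a1 := h.hvb
    have a2 := h.hcd
    have a3 := h.hvc
    have a4 := h.hbd
    by_cases x1 : x = v <;> by_cases x2 : x = b <;> by_cases x3 : x = c <;>
      by_cases x4 : x = d <;> simp_all
  all_goals simp [*]

/-- Both switched edges are retained ones, so the set of deleted edges does not change. With
`card_switch` this shows that the weight p^|T| (1-p)^|E \ T| is invariant. -/
theorem sdiff_switch (h : Switchable v b c d E) (h' : Switchable v b c d T) :
    switch v b c d E \ switch v b c d T = E \ T := by
  have h1 := h'.vb
  have h2 := h'.cd
  have h3 := h.vc
  have h4 := h.bd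
  have h5 := h'.vc
  have h6 := h'.bd
  unfold switch
  generalize s(v, b) = e1, s(c, d) = e2, s(v, c) = e3, s(b, d) = e4 at *
  ext e
  simp only [Finset.mem_insert, Finset.mem_sdiff, Finset.mem_singleton]
  by_cases x1 : e = e1 <;> by_cases x2 : e = e2 <;> by_cases x3 : e = e3 <;>
    by_cases x4 : e = e4 <;> simp_all

theorem switch_mem_edgeSets (h : Switchable v b c d E) (hE : E ∈ edgeSets D) :
    switch v b c d E ∈ edgeSets D := by
  obtain ⟨-, h1, h2⟩ := mem_filter.1 hE
  refine mem_filter.2 ⟨mem_univ _, fun e he => ?_, fun x => by rw [h.edgeDeg_switch, h2]⟩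
  rcases mem_insert.1 he with rfl | he
  · exact h.hvc
  rcases mem_insert.1 he with rfl | he
  · exact h.hbd
  · exact h1 e (Finset.mem_sdiff.1 he).1

end Switchable

theorem mk_left_mem_switch : s(v, c) ∈ switch v b c d T := mem_insert_self _ _

theorem mk_right_mem_switch : s(b, d) ∈ switch v b c d T :=
  mem_insert_of_mem (mem_insert_self _ _)

theorem switch_subset_switch (h : T ⊆ E) : switch v b c d T ⊆ switch v b c d E :=
  insert_subset_insert _ (insert_subset_insert _ (sdiff_subset_sdiff h (subset_refl _)))

/-- Switching preserves the joint law of the random graph and of its percolation. -/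
theorem totalExp_switch_le (h0 : 0 ≤ p) (h1 : p ≤ 1) (hvc : v ≠ c) (hbd : b ≠ d)
    (hF : ∀ E T, 0 ≤ F E T) :
    totalExp p D (fun E T => if s(v, b) ∈ T ∧ s(c, d) ∈ T ∧ s(v, c) ∉ E ∧ s(b, d) ∉ E then
        F (switch v b c d E) (switch v b c d T) else 0) ≤
      totalExp p D (fun E T => if s(v, c) ∈ T ∧ s(b, d) ∈ T then F E T else 0) := by
  have hp : 0 ≤ 1 - p := by linarith
  unfold totalExp bernExp
  rw [sum_sigma', sum_sigma']
  simp only [mul_ite, mul_zero]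
  rw [← sum_filter, ← sum_filter]
  set S1 := ((edgeSets D).sigma fun E => E.powerset).filter fun x =>
    s(v, b) ∈ x.2 ∧ s(c, d) ∈ x.2 ∧ s(v, c) ∉ x.1 ∧ s(b, d) ∉ x.1 with hS1
  have hsw : ∀ x ∈ S1, Switchable v b c d x.1 ∧ Switchable v b c d x.2 ∧ x.2 ⊆ x.1 ∧
      x.1 ∈ edgeSets D := by
    rintro ⟨E, T⟩ hx
    obtain ⟨hx1, hx2, hx3, hx4, hx5⟩ := mem_filter.1 hx
    obtain ⟨hE, hT⟩ := mem_sigma.1 hx1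
    have hT' : T ⊆ E := mem_powerset.1 hT
    dsimp only at hx2 hx3 hx4 hx5 hE
    have n1 := ne_of_mem_edgeSets hE (hT' hx2)
    have n2 := ne_of_mem_edgeSets hE (hT' hx3)
    exact ⟨⟨hT' hx2, hT' hx3, hx4, hx5, n1, n2, hvc, hbd⟩,
      ⟨hx2, hx3, fun h => hx4 (hT' h), fun h => hx5 (hT' h), n1, n2, hvc, hbd⟩, hT', hE⟩
  let i : (_ : Finset (Sym2 V)) × Finset (Sym2 V) → (_ : Finset (Sym2 V)) × Finset (Sym2 V) :=
    fun x => ⟨switch v b c d x.1, switch v b c d x.2⟩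
  have hinj : Set.InjOn i S1 := by
    intro x hx y hy hxy
    obtain ⟨a1, a2, -, -⟩ := hsw x hx
    obtain ⟨b1, b2, -, -⟩ := hsw y hy
    have e1 : switch v b c d x.1 = switch v b c d y.1 := congrArg Sigma.fst hxy
    have e2 : switch v b c d x.2 = switch v b c d y.2 := congrArg (fun z => z.2) hxy
    have f1 : x.1 = y.1 := by rw [← a1.switch_switch, ← b1.switch_switch, e1]
    have f2 : x.2 = y.2 := by rw [← a2.switch_switch, ← b2.switch_switch, e2]
    exact Sigma.ext f1 (heq_of_eq f2)
  calc _ = ∑ x ∈ S1, p ^ #(i x).2 * (1 - p) ^ #((i x).1 \ (i x).2) * F (i x).1 (i x).2 := by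
        refine sum_congr rfl fun x hx => ?_
        obtain ⟨a1, a2, -, -⟩ := hsw x hx
        simp only [i]
        rw [a2.card_switch, a1.sdiff_switch a2]
    _ = ∑ y ∈ S1.image i, p ^ #y.2 * (1 - p) ^ #(y.1 \ y.2) * F y.1 y.2 := by
        rw [sum_image hinj]
    _ ≤ _ := by
        refine sum_le_sum_of_subset_of_nonneg (fun y hy => ?_) fun y _ _ => ?_
        · obtain ⟨x, hx, rfl⟩ := mem_image.1 hy
          obtain ⟨a1, a2, a3, a4⟩ := hsw x hx
          exact mem_filter.2 ⟨mem_sigma.2 ⟨a1.switch_mem_edgeSets a4,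
            mem_powerset.2 (switch_subset_switch a3)⟩, mk_left_mem_switch, mk_right_mem_switch⟩
        · have := hF y.1 y.2
          positivity

end Switching

/-! ### Pairs of edges in different components -/

section DisconnectedPairs

variable {V : Type*} [DecidableEq V] [Fintype V]
variable {p : ℝ} {D : V → ℕ} {W : Finset V} {E T L : Finset (Sym2 V)} {v b c d : V}

theorem sum4_reindex (f : V → V → V → V → ℝ) :
    (∑ x : V × V, ∑ y : V × V, f x.1 x.2 y.2 y.1 = ∑ x : V × V, ∑ y : V × V, f x.1 x.2 y.1 y.2) ∧
    (∑ x : V × V, ∑ y : V × V, f x.2 x.1 y.1 y.2 = ∑ x : V × V, ∑ y : V × V, f x.1 x.2 y.1 y.2) ∧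
    (∑ x : V × V, ∑ y : V × V, f y.1 y.2 x.1 x.2 = ∑ x : V × V, ∑ y : V × V, f x.1 x.2 y.1 y.2) ∧
    (∑ x : V × V, ∑ y : V × V, f y.2 y.1 x.1 x.2 = ∑ x : V × V, ∑ y : V × V, f x.1 x.2 y.1 y.2) := by
  have h1 : ∀ g : V → V → ℝ, ∑ y : V × V, g y.2 y.1 = ∑ y : V × V, g y.1 y.2 := fun g =>
    (Equiv.prodComm V V).sum_comp fun y : V × V => g y.1 y.2
  refine ⟨sum_congr rfl fun x _ => h1 _, h1 fun a a' => ∑ y : V × V, f a a' y.1 y.2, sum_comm, ?_⟩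
  rw [sum_comm]
  exact h1 fun a a' => ∑ y : V × V, f a a' y.1 y.2

theorem sum4_eq (f : V → V → V → V → ℝ) :
    ∑ x : V × V, ∑ y : V × V, f x.1 x.2 y.1 y.2 = ∑ v, ∑ b, ∑ c, ∑ d, f v b c d := by
  rw [Fintype.sum_prod_type]
  refine sum_congr rfl fun v _ => sum_congr rfl fun b _ => ?_
  rw [Fintype.sum_prod_type]

/-- The indicator of two oriented edges lying in different components. -/
def sepPair (L : Finset (Sym2 V)) (v b c d : V) : ℝ :=
  if s(v, b) ∈ L ∧ s(c, d) ∈ L ∧ ¬ Reach L v c then 1 else 0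

/-- The indicator of a separated pair of oriented edges that can be switched. -/
def sepSwitchable (E L : Finset (Sym2 V)) (v b c d : V) : ℝ :=
  if s(v, c) ∉ E ∧ s(b, d) ∉ E then sepPair L v b c d else 0

/-- The indicator of a separated pair of oriented edges such that the first end of the first edge
is adjacent in `E` to both ends of the second. -/
def sepBlocked (E L : Finset (Sym2 V)) (v b c d : V) : ℝ :=
  if s(v, c) ∈ E ∧ s(v, d) ∈ E then sepPair L v b c d else 0

theorem sepPair_nonneg : 0 ≤ sepPair L v b c d := by
  unfold sepPair
  split_ifs <;> norm_num

theorem sepPair_symm_right : sepPair L v b d c = sepPair L v b c d := by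
  unfold sepPair
  rw [Sym2.eq_swap (a := d)]
  by_cases h : s(c, d) ∈ L
  · have : Reach L v d ↔ Reach L v c :=
      ⟨fun h' => h'.trans (Reach.of_mem h).symm, fun h' => h'.trans (Reach.of_mem h)⟩
    simp only [this]
  · simp [h]

theorem sepPair_comm : sepPair L c d v b = sepPair L v b c d := by
  unfold sepPair
  have : Reach L c v ↔ Reach L v c := ⟨fun h => h.symm, fun h => h.symm⟩
  simp only [this]
  congr 1
  exact propext ⟨fun h => ⟨h.2.1, h.1, h.2.2⟩, fun h => ⟨h.2.1, h.1, h.2.2⟩⟩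

theorem sepPair_symm_left : sepPair L b v c d = sepPair L v b c d := by
  rw [sepPair_comm (v := c) (b := d), sepPair_symm_right, sepPair_comm]

/-- If a separated pair of edges cannot be switched in either orientation, an end of one of the
edges is adjacent to both ends of the other edge. -/
theorem sepPair_le : sepPair L v b c d ≤
    sepSwitchable E L v b c d + sepSwitchable E L v b d c + (sepBlocked E L v b c d +
      sepBlocked E L b v c d + (sepBlocked E L c d v b + sepBlocked E L d c v b)) := by
  have h0 := sepPair_nonneg (L := L) (v := v) (b := b) (c := c) (d := d)
  have e1 : sepPair L d c v b = sepPair L v b c d := by rw [sepPair_comm, sepPair_symm_right]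
  unfold sepSwitchable sepBlocked
  rw [e1, sepPair_symm_right (c := c), sepPair_comm (v := v), sepPair_symm_left (v := v),
    Sym2.eq_swap (a := c) (b := v), Sym2.eq_swap (a := c) (b := b), Sym2.eq_swap (a := d) (b := v),
    Sym2.eq_swap (a := d) (b := b)]
  by_cases h1 : s(v, c) ∈ E <;> by_cases h2 : s(v, d) ∈ E <;> by_cases h3 : s(b, c) ∈ E <;>
    by_cases h4 : s(b, d) ∈ E <;> simp [h1, h2, h3, h4] <;> linarith

/-- Without the two new edges only old edges remain, so a path from b to d there would have joined
the two original edges already before the switch. -/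
theorem within_switch_erase_subset :
    ((within W (switch v b c d T)).erase s(v, c)).erase s(b, d) ⊆ within W T := by
  intro e he
  obtain ⟨h1, he⟩ := mem_erase.1 he
  obtain ⟨h2, he⟩ := mem_erase.1 he
  obtain ⟨he, h3⟩ := mem_filter.1 he
  refine mem_filter.2 ⟨?_, h3⟩
  rcases mem_insert.1 he with h | he
  · exact absurd h h2
  rcases mem_insert.1 he with h | he
  · exact absurd h h1
  · exact (Finset.mem_sdiff.1 he).1

/-- The indicator of an edge `vc` such that `bd` is a bridge after the removal of `vc`. -/
def bridgePair (L : Finset (Sym2 V)) (v b c d : V) : ℝ :=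
  if s(v, c) ∈ L ∧ s(b, d) ∈ L.erase s(v, c) ∧
    ¬ Reach ((L.erase s(v, c)).erase s(b, d)) b d then 1 else 0

/-- The switch turns a separated pair into an edge vc and a bridge bd of the rest, and preserves the
joint law. The cases v = c and b = d, where no switch exists, are not separated. -/
theorem totalExp_sepSwitchable_le (h0 : 0 ≤ p) (h1 : p ≤ 1) :
    totalExp p D (fun E T => sepSwitchable E (within W T) v b c d) ≤
      totalExp p D (fun _ T => bridgePair (within W T) v b c d) := by
  have hn : ∀ T : Finset (Sym2 V), 0 ≤ bridgePair (within W T) v b c d := fun T => by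
    unfold bridgePair
    split_ifs <;> norm_num
  by_cases hvc : v = c
  · refine totalExp_mono h0 h1 fun E _ T _ => ?_
    have : sepPair (within W T) v b c d = 0 := if_neg fun h => h.2.2 (hvc ▸ Reach.refl _ _)
    unfold sepSwitchable
    rw [this, ite_self]
    exact hn T
  by_cases hbd : b = d
  · refine totalExp_mono h0 h1 fun E _ T _ => ?_
    have : sepPair (within W T) v b c d = 0 := if_neg fun h => h.2.2
      ((Reach.of_mem h.1).trans (hbd ▸ (Reach.of_mem h.2.1).symm))
    unfold sepSwitchable
    rw [this, ite_self]
    exact hn T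
  refine le_trans (totalExp_mono h0 h1 fun E hE T hT => ?_) (le_trans (totalExp_switch_le h0 h1 hvc
    hbd (D := D) (F := fun _ T => bridgePair (within W T) v b c d) fun _ T => hn T)
    (totalExp_mono h0 h1 fun E hE T hT => ?_))
  · by_cases h : s(v, c) ∉ E ∧ s(b, d) ∉ E ∧ s(v, b) ∈ within W T ∧ s(c, d) ∈ within W T ∧
        ¬ Reach (within W T) v c
    · obtain ⟨h2, h3, h4, h5, h6⟩ := h
      obtain ⟨a1, a2, a3⟩ := mk_mem_within.1 h4
      obtain ⟨b1, b2, b3⟩ := mk_mem_within.1 h5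
      have hsw : Switchable v b c d E := ⟨hT a1, hT b1, h2, h3, ne_of_mem_edgeSets hE (hT a1),
        ne_of_mem_edgeSets hE (hT b1), hvc, hbd⟩
      rw [if_pos ⟨a1, b1, h2, h3⟩]
      have hb : bridgePair (within W (switch v b c d T)) v b c d = 1 := by
        refine if_pos ⟨mk_mem_within.2 ⟨mk_left_mem_switch, a2, b2⟩, mem_erase.2
          ⟨hsw.vc_ne_bd.symm, mk_mem_within.2 ⟨mk_right_mem_switch, a3, b3⟩⟩, fun hr => h6 ?_⟩
        exact (Reach.of_mem h4).trans ((hr.mono within_switch_erase_subset).trans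
          (Reach.of_mem h5).symm)
      rw [hb]
      unfold sepSwitchable sepPair
      split_ifs <;> norm_num
    · have : sepSwitchable E (within W T) v b c d = 0 := by
        unfold sepSwitchable sepPair
        rw [← ite_and]
        exact if_neg fun h' => h ⟨h'.1.1, h'.1.2, h'.2⟩
      rw [this]
      split_ifs
      · exact hn _
      · exact le_rfl
  · split_ifs
    · exact le_rfl
    · exact hn _

/-- There are at most 2|L| oriented edges vc, and after deleting one of them at most 2|W| oriented
bridges bd. -/
theorem sum_bridgePair_le (hL : within W L = L) :
    ∑ v, ∑ b, ∑ c, ∑ d, bridgePair L v b c d ≤ 4 * #W * #L := by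
  have h1 : ∀ v, ∑ b, ∑ c, ∑ d, bridgePair L v b c d ≤ 2 * #W * edgeDeg L v := fun v => by
    rw [sum_comm, ← sum_mk_mem, mul_sum]
    refine sum_le_sum fun c _ => ?_
    by_cases hc : s(v, c) ∈ L
    · have hL' : within W (L.erase s(v, c)) = L.erase s(v, c) := by
        rw [← within_inter (erase_subset _ _), hL]
        exact inter_eq_left.2 (erase_subset _ _)
      simp only [bridgePair, hc, true_and, if_true, mul_one]
      exact sum_bridges_le hL'
    · simp [bridgePair, hc]
  refine le_trans (sum_le_sum fun v _ => h1 v) ?_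
  rw [← mul_sum]
  have h2 : ((∑ x, edgeDeg L x : ℕ) : ℝ) ≤ 2 * #L := by exact_mod_cast sum_edgeDeg_le L
  push_cast at h2
  nlinarith [Nat.cast_nonneg (α := ℝ) (#W)]

theorem edgeDeg_eq_zero (hL : within W L = L) (hv : v ∉ W) : edgeDeg L v = 0 := by
  rw [edgeDeg, card_eq_zero, filter_eq_empty_iff]
  intro e he hve
  rw [← hL] at he
  exact hv ((mem_filter.1 he).2 v hve)

theorem edgeDeg_inter_touching {Z : Finset V} (hT : T ⊆ E) (hv : v ∈ Z) :
    edgeDeg (T ∩ touching Z E) v = edgeDeg T v := by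
  unfold edgeDeg
  congr 1
  ext e
  simp only [mem_filter, Finset.mem_inter, touching]
  exact ⟨fun h => ⟨h.1.1, h.2⟩, fun h => ⟨⟨h.1, hT h.1, fun h' => h' v hv h.2⟩, h.2⟩⟩

theorem bernExp_touching_edgeDeg {Z : Finset V} (hv : v ∈ Z) (g : ℕ → ℝ) :
    bernExp p (touching Z E) (fun T => g (edgeDeg T v)) =
      bernExp p E (fun T => g (edgeDeg T v)) := by
  rw [← bernExp_inter (touching_subset Z E)]
  exact bernExp_congr fun T hT => by rw [edgeDeg_inter_touching hT hv]

theorem edgeDeg_mono {T T' : Finset (Sym2 V)} (h : T ⊆ T') (v : V) : edgeDeg T v ≤ edgeDeg T' v :=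
  card_le_card (filter_subset_filter _ h)

/-- Summing over b produces the degree of v, which can only fall when edges at v are removed. It can
thus serve as f in `bernExp_unreached_le`, and both ends of cd lie among the neighbours of v, where
the weighted count is at most 3|W|. -/
theorem bernExp_sepBlocked_vertex_le (h0 : 0 ≤ p) (h1 : p ≤ 1) (v : V) :
    bernExp p (within W E) (fun T => ∑ b, ∑ c, ∑ d, sepBlocked E T v b c d) ≤
      bernExp p (within W E) (fun T => (edgeDeg T v : ℝ)) * (3 * #W) := by
  have hK : within W (within W E) = within W E := by
    rw [← within_inter (within_subset W E), Finset.inter_self]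
  have hKT : ∀ T ⊆ within W E, within W T = T := fun T hT => by
    rw [← within_inter hT, hK, inter_eq_left.2 hT]
  set K := within W E with hKdef
  set N := outNbrs W {v} K v with hN
  have key := bernExp_unreached_le h0 h1 K W {v} (mem_singleton_self v)
    (fun T => (edgeDeg T v : ℝ)) (fun T => Nat.cast_nonneg _)
    (fun T M _ => Nat.cast_le.2 (edgeDeg_mono sdiff_subset v)) N (fun _ _ _ => 1)
    (fun _ _ _ => zero_le_one)
  have hNW : N ⊆ W := filter_subset _ _
  have hA : within W (within W (avoiding {v} K)) = within W (avoiding {v} K) := by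
    rw [← within_inter (within_subset W _), Finset.inter_self]
  have h3 := bernExp_sum_edges_inside_le h0 h1 hA hNW
  have hdeg := bernExp_touching_edgeDeg (p := p) (E := K) (mem_singleton_self v) (fun k => (k : ℝ))
  rw [hdeg] at key
  have hnn : 0 ≤ bernExp p K (fun T => (edgeDeg T v : ℝ)) :=
    bernExp_nonneg h0 h1 fun T _ => Nat.cast_nonneg _
  refine le_trans (bernExp_mono h0 h1 fun T hT => ?_)
    (key.trans (mul_le_mul_of_nonneg_left h3 hnn))
  rw [edgeDeg_inter_touching hT (mem_singleton_self v), ← sum_mk_mem, sum_mul]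
  refine sum_le_sum fun b _ => ?_
  by_cases hvb : s(v, b) ∈ T
  · rw [if_pos hvb, one_mul]
    have hnn : ∀ c d, (0 : ℝ) ≤ if s(c, d) ∈ within W T ∧ Unreached T {v} c then 1 else 0 :=
      fun c d => by split_ifs <;> norm_num
    have hz : ∀ c d, sepBlocked E T v b c d ≤ if c ∈ N then (if d ∈ N then
        (if s(c, d) ∈ within W T ∧ Unreached T {v} c then 1 else 0) else 0) else 0 := fun c d => by
      by_cases h : (s(v, c) ∈ E ∧ s(v, d) ∈ E) ∧ s(v, b) ∈ T ∧ s(c, d) ∈ T ∧ ¬ Reach T v c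
      · obtain ⟨⟨e1, e2⟩, e3, e4, e5⟩ := h
        have hvW : v ∈ W := (mk_mem_within.1 (hT e3)).2.1
        obtain ⟨-, hcW, hdW⟩ := mk_mem_within.1 (hT e4)
        have hcv : c ≠ v := fun h => e5 (h ▸ Reach.refl _ _)
        have hdv : d ≠ v := fun h => e5 (h ▸ (Reach.of_mem e4).symm)
        have hc : c ∈ N := mem_filter.2 ⟨hcW, by simpa using hcv, mk_mem_within.2 ⟨e1, hvW, hcW⟩⟩
        have hd : d ∈ N := mem_filter.2 ⟨hdW, by simpa using hdv, mk_mem_within.2 ⟨e2, hvW, hdW⟩⟩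
        have hu : Unreached T {v} c := fun z hz => (mem_singleton.1 hz) ▸ e5
        rw [if_pos hc, if_pos hd, if_pos ⟨(hKT T hT).symm ▸ e4, hu⟩]
        unfold sepBlocked sepPair
        split_ifs <;> norm_num
      · have : sepBlocked E T v b c d = 0 := by
          unfold sepBlocked sepPair
          rw [← ite_and]
          exact if_neg h
        rw [this]
        split_ifs <;> norm_num
    refine le_trans (sum_le_sum fun c _ => sum_le_sum fun d _ => hz c d) (le_of_eq ?_)
    rw [← sum_filter_add_sum_filter_not univ (· ∈ N), filter_mem_eq_inter, univ_inter]
    rw [sum_congr rfl (g := fun c => ∑ d ∈ N,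
      if s(c, d) ∈ within W T ∧ Unreached T {v} c then (1 : ℝ) else 0), sum_eq_zero (s := filter _ _),
      add_zero]
    · intro c hc
      simp [(mem_filter.1 hc).2]
    · intro c hc
      simp only [hc, if_true]
      rw [sum_ite_mem, univ_inter]
  · rw [if_neg hvb, zero_mul]
    refine le_of_eq (sum_eq_zero fun c _ => sum_eq_zero fun d _ => ?_)
    unfold sepBlocked sepPair
    simp [hvb]

/-- The expected number of pairs of oriented edges inside `W` in different components. -/
theorem totalExp_sepPair_le (h0 : 0 ≤ p) (h1 : p ≤ 1) {κ : ℝ}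
    (hκ : ∀ E ∈ edgeSets D, (#(within W E) : ℝ) ≤ κ) :
    totalExp p D (fun _ T => ∑ v, ∑ b, ∑ c, ∑ d, sepPair (within W T) v b c d) ≤
      #(edgeSets D) * (32 * #W * (p * κ)) := by
  have hK : ∀ E : Finset (Sym2 V), within W (within W E) = within W E := fun E => by
    rw [← within_inter (within_subset W E), Finset.inter_self]
  have hW : (0 : ℝ) ≤ #W := Nat.cast_nonneg _
  have hpt : ∀ E ∈ edgeSets D, ∀ T ⊆ E,
      ∑ v, ∑ b, ∑ c, ∑ d, sepPair (within W T) v b c d ≤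
        2 * (∑ v, ∑ b, ∑ c, ∑ d, sepSwitchable E (within W T) v b c d) +
          4 * (∑ v, ∑ b, ∑ c, ∑ d, sepBlocked E (within W T) v b c d) := by
    intro E _ T _
    rw [← sum4_eq, ← sum4_eq, ← sum4_eq]
    -- After relabelling the summation variables, the two switchable terms have equal sums, and so
    -- do the four blocked ones.
    refine le_trans (sum_le_sum fun x _ => sum_le_sum fun y _ => sepPair_le (E := E)) ?_
    simp only [sum_add_distrib]
    obtain ⟨r1, -, -, -⟩ := sum4_reindex fun v b c d =>
      sepSwitchable E (within W T) v b c d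
    obtain ⟨-, r2, r3, r4⟩ := sum4_reindex fun v b c d =>
      sepBlocked E (within W T) v b c d
    rw [r1, r2, r3, r4]
    linarith
  refine (totalExp_mono h0 h1 hpt).trans ?_
  rw [totalExp_add, totalExp_const_mul, totalExp_const_mul]
  have hS : totalExp p D (fun E T => ∑ v, ∑ b, ∑ c, ∑ d, sepSwitchable E (within W T) v b c d) ≤
      #(edgeSets D) * (4 * #W * (p * κ)) := by
    have e1 : totalExp p D
        (fun E T => ∑ v, ∑ b, ∑ c, ∑ d, sepSwitchable E (within W T) v b c d) ≤
        totalExp p D (fun _ T => ∑ v, ∑ b, ∑ c, ∑ d, bridgePair (within W T) v b c d) := by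
      simp only [totalExp_sum]
      exact sum_le_sum fun v _ => sum_le_sum fun b _ => sum_le_sum fun c _ => sum_le_sum fun d _ =>
        totalExp_sepSwitchable_le h0 h1
    refine e1.trans (totalExp_le_of_forall fun E hE => ?_)
    refine le_trans (bernExp_mono h0 h1 (F' := fun T => 4 * #W * (#(T ∩ within W E) : ℝ))
      fun T hT => ?_) ?_
    · rw [within_inter hT]
      exact sum_bridgePair_le (hK T)
    · rw [bernExp_const_mul, bernExp_card_inter (within_subset W E)]
      exact mul_le_mul_of_nonneg_left (mul_le_mul_of_nonneg_left (hκ E hE) h0) (by positivity)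
  have hB : totalExp p D (fun E T => ∑ v, ∑ b, ∑ c, ∑ d, sepBlocked E (within W T) v b c d) ≤
      #(edgeSets D) * (6 * #W * (p * κ)) := by
    refine totalExp_le_of_forall fun E hE => ?_
    have e1 : bernExp p E (fun T => ∑ v, ∑ b, ∑ c, ∑ d, sepBlocked E (within W T) v b c d) =
        bernExp p (within W E) (fun T => ∑ v, ∑ b, ∑ c, ∑ d, sepBlocked E T v b c d) := by
      rw [← bernExp_inter (within_subset W E)]
      exact bernExp_congr fun T hT => by rw [within_inter hT]
    rw [e1, bernExp_sum]
    refine le_trans (sum_le_sum fun v _ => bernExp_sepBlocked_vertex_le h0 h1 v) ?_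
    rw [← sum_mul, ← bernExp_sum]
    have e2 : bernExp p (within W E) (fun T => ∑ v, (edgeDeg T v : ℝ)) ≤ 2 * (p * κ) := by
      refine le_trans (bernExp_mono h0 h1 (F' := fun T => 2 * (#T : ℝ)) fun T _ => ?_) ?_
      · exact_mod_cast sum_edgeDeg_le T
      · rw [bernExp_const_mul, bernExp_card]
        exact mul_le_mul_of_nonneg_left (mul_le_mul_of_nonneg_left (hκ E hE) h0) (by norm_num)
    nlinarith
  nlinarith

end DisconnectedPairs

/-! ### Large components not joined to a vertex of high degree -/

section FarEdges

variable {V : Type*} [DecidableEq V] [Fintype V]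
variable {p β : ℝ} {D : V → ℕ} {W : Finset V} {E T L : Finset (Sym2 V)} {v b c d : V} {k : ℕ}

/-- The indicator of a vertex of degree at least `k`. -/
def highInd (k : ℕ) (T : Finset (Sym2 V)) (v : V) : ℝ := if k ≤ edgeDeg T v then 1 else 0

/-- The indicator of a vertex of degree at least `k`, divided by the degree. -/
def highWeight (k : ℕ) (T : Finset (Sym2 V)) (v : V) : ℝ := highInd k T v / edgeDeg T v

/-- The indicator of an oriented edge inside `W` in a component of size at least `β` inside `W`
that is not joined to `v`. -/
def farEdge (W : Finset V) (β : ℝ) (T : Finset (Sym2 V)) (v c d : V) : ℝ :=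
  if s(c, d) ∈ within W T ∧ ¬ Reach T v c ∧ β ≤ compSize (within W T) c then 1 else 0

theorem highInd_nonneg : 0 ≤ highInd k T v := by
  unfold highInd
  split_ifs <;> norm_num

theorem highWeight_nonneg : 0 ≤ highWeight k T v := div_nonneg highInd_nonneg (Nat.cast_nonneg _)

theorem farEdge_nonneg : 0 ≤ farEdge W β T v c d := by
  unfold farEdge
  split_ifs <;> norm_num

/-- This spreads the unit mass of a high vertex v evenly over its percolated edges vb, which
supplies an edge to switch. The assumption on k excludes degree 0. -/
theorem sum_mem_mul_highWeight (hk : 1 ≤ k) :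
    ∑ b, (if s(v, b) ∈ T then highWeight k T v else 0) = highInd k T v := by
  have h : ∀ b, (if s(v, b) ∈ T then highWeight k T v else 0) =
      (if s(v, b) ∈ T then 1 else 0) * highWeight k T v := fun b => by split_ifs <;> simp
  simp only [h]
  rw [← sum_mul, sum_mk_mem, highWeight]
  by_cases hd : edgeDeg T v = 0
  · have : highInd k T v = 0 := if_neg (by omega)
    simp [this]
  · exact mul_div_cancel₀ _ (Nat.cast_ne_zero.2 hd)

theorem highInd_mono {T T' : Finset (Sym2 V)} (h : T ⊆ T') : highInd k T v ≤ highInd k T' v := by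
  unfold highInd
  have := edgeDeg_mono h v
  split_ifs <;> first | omega | norm_num

theorem farEdge_symm : farEdge W β T v d c = farEdge W β T v c d := by
  unfold farEdge
  rw [Sym2.eq_swap (a := d)]
  by_cases h : s(c, d) ∈ within W T
  · have hr := Reach.of_mem h
    have h1 : Reach T v d ↔ Reach T v c :=
      ⟨fun h' => h'.trans (hr.mono (within_subset _ _)).symm,
        fun h' => h'.trans (hr.mono (within_subset _ _))⟩
    rw [h1, compSize_congr hr]
  · simp [h]

/-- A component that misses Z survives the deletion of all edges at Z. Its size can therefore be
read off edges that are independent of those at Z. -/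
theorem compSize_within_le {Z : Finset V} (h : Unreached T Z c) :
    compSize (within W T) c ≤ compSize (within W (avoiding Z T)) c := by
  have hL : Unreached (within W T) Z c := fun z hz hr => h z hz (hr.mono (within_subset _ _))
  have hsub : avoiding Z (within W T) ⊆ within W (avoiding Z T) := fun e he => by
    obtain ⟨he, h2⟩ := mem_filter.1 he
    obtain ⟨he, h3⟩ := mem_filter.1 he
    exact mem_filter.2 ⟨mem_filter.2 ⟨he, h2⟩, h3⟩
  refine card_le_card fun f hf => ?_
  obtain ⟨hf, x, hx, hr⟩ := mem_filter.1 hf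
  refine mem_filter.2 ⟨hsub (mem_filter.2 ⟨hf, fun z hz hzf => hL z hz ?_⟩), x, hx,
    (reach_of_unreached hL hr).mono hsub⟩
  induction f with
  | _ a a' =>
    have haa := Reach.of_mem hf
    rcases Sym2.mem_iff.1 hzf with rfl | rfl <;> rcases Sym2.mem_iff.1 hx with rfl | rfl
    · exact hr.symm
    · exact haa.trans hr.symm
    · exact haa.symm.trans hr.symm
    · exact hr.symm

/-- The contribution of far edges at the neighbours of `x`. -/
theorem bernExp_far_at_le (h0 : 0 ≤ p) (h1 : p ≤ 1) (hβ : 1 < β) {κ : ℝ}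
    (hκ : (#(within W E) : ℝ) ≤ κ) {x : V} {Z : Finset V} (hx : x ∈ Z)
    (f : Finset (Sym2 V) → ℝ) (hf0 : ∀ T, 0 ≤ f T)
    (hf : ∀ T, ∀ M ⊆ (outNbrs W Z E x).image (fun y => s(x, y)), f (T \ M) ≤ f T)
    (hfE : ∀ T ⊆ E, f (T ∩ touching Z E) = f T)
    (hfZ : ∀ T ⊆ E, f T ≠ 0 → ∀ z ∈ Z, Reach T v z) :
    bernExp p E (fun T => f T * ∑ c, ∑ d, if s(x, c) ∈ E then farEdge W β T v c d else 0) ≤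
      bernExp p E f * (2 * #W + #W * (p * κ) / (β - 1)) := by
  have key := bernExp_unreached_le h0 h1 E W Z hx f hf0 hf univ
    (fun c _ T => if β ≤ compSize T c then 1 else 0) (fun c d T => by split_ifs <;> norm_num)
  have hA : within W (within W (avoiding Z E)) = within W (avoiding Z E) := by
    rw [← within_inter (within_subset W _), Finset.inter_self]
  have h3 := bernExp_sum_edges_large_le (N := outNbrs W Z E x) h0 h1 hA hβ
  have hfe : bernExp p (touching Z E) f = bernExp p E f := by
    rw [← bernExp_inter (touching_subset Z E)]
    exact bernExp_congr hfE
  rw [hfe] at key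
  have hnn : 0 ≤ bernExp p E f := bernExp_nonneg h0 h1 fun T _ => hf0 T
  have hβ' : 0 < β - 1 := by linarith
  have h4 : 2 * (#W : ℝ) + #W * (p * #(within W (avoiding Z E))) / (β - 1) ≤
      2 * #W + #W * (p * κ) / (β - 1) := by
    have h5 : (#(within W (avoiding Z E)) : ℝ) ≤ κ := le_trans
      (Nat.cast_le.2 (card_le_card (within_mono W (avoiding_subset Z E)))) hκ
    gcongr
  refine le_trans (bernExp_mono h0 h1 fun T hT => ?_)
    (key.trans (mul_le_mul_of_nonneg_left (h3.trans h4) hnn))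
  rw [hfE T hT]
  by_cases hfT : f T = 0
  · simp [hfT]
  have hreach := hfZ T hT hfT
  refine mul_le_mul_of_nonneg_left ?_ (hf0 T)
  have hz : ∀ c, (∑ d, if s(x, c) ∈ E then farEdge W β T v c d else 0) ≤
      if c ∈ outNbrs W Z E x then ∑ d, (if s(c, d) ∈ within W T ∧ Unreached T Z c then
        (if β ≤ compSize (T ∩ within W (avoiding Z E)) c then (1 : ℝ) else 0) else 0) else 0 := by
    intro c
    by_cases hc : c ∈ outNbrs W Z E x
    · rw [if_pos hc]
      refine sum_le_sum fun d _ => ?_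
      by_cases h : s(c, d) ∈ within W T ∧ ¬ Reach T v c ∧ β ≤ compSize (within W T) c
      · obtain ⟨a1, a2, a3⟩ := h
        have hu : Unreached T Z c := fun z hz hr => a2 ((hreach z hz).trans hr)
        have hi : T ∩ within W (avoiding Z E) = within W (avoiding Z T) := by
          ext e
          simp only [Finset.mem_inter, within, avoiding, mem_filter]
          exact ⟨fun h => ⟨⟨h.1, h.2.1.2⟩, h.2.2⟩, fun h => ⟨h.1.1, ⟨hT h.1.1, h.1.2⟩, h.2⟩⟩
        have hq : s(c, d) ∈ within W T ∧ Unreached T Z c := ⟨a1, hu⟩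
        rw [if_pos hq, hi, if_pos (a3.trans (Nat.cast_le.2 (compSize_within_le hu)))]
        unfold farEdge
        split_ifs <;> norm_num
      · have : farEdge W β T v c d = 0 := if_neg h
        rw [this]
        split_ifs <;> norm_num
    · rw [if_neg hc]
      refine le_of_eq (sum_eq_zero fun d _ => ?_)
      split_ifs with hxc
      · refine if_neg fun h => hc (mem_filter.2 ⟨(mk_mem_within.1 h.1).2.1, fun hcZ => ?_, hxc⟩)
        exact h.2.1 (hreach c hcZ)
      · rfl
  refine le_trans (sum_le_sum fun c _ => hz c) (le_of_eq ?_)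
  rw [sum_ite_mem, univ_inter]

/-- The indicator of an edge `bd` with `d ∈ W` that is either a bridge inside `W` after the removal
of `vc`, or has its end `b` outside of `W`. -/
def linkEdge (W : Finset V) (T : Finset (Sym2 V)) (v b c d : V) : ℝ :=
  (if s(b, d) ∈ (within W T).erase s(v, c) ∧
    ¬ Reach (((within W T).erase s(v, c)).erase s(b, d)) b d then 1 else 0) +
  if b ∉ W ∧ d ∈ W ∧ s(b, d) ∈ avoiding {v} T then 1 else 0

theorem linkEdge_nonneg : 0 ≤ linkEdge W T v b c d := by
  unfold linkEdge
  positivity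

/-- The degree of v is invariant under the switch, hence so is its weight. Unlike in the case of
separated pairs, b need not lie in W: if it does, bd becomes a bridge as before, and otherwise it is
an edge leaving W. -/
theorem totalExp_farEdge_switch_le (h0 : 0 ≤ p) (h1 : p ≤ 1) :
    totalExp p D (fun E T => if s(v, b) ∈ T ∧ s(v, c) ∉ E ∧ s(b, d) ∉ E then
        highWeight k T v * farEdge W β T v c d else 0) ≤
      totalExp p D (fun _ T => if s(v, c) ∈ T then
        highWeight k T v * linkEdge W T v b c d else 0) := by
  have hn : ∀ T : Finset (Sym2 V), 0 ≤ highWeight k T v * linkEdge W T v b c d := fun T =>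
    mul_nonneg highWeight_nonneg linkEdge_nonneg
  by_cases hvc : v = c
  · refine totalExp_mono h0 h1 fun E _ T _ => ?_
    have : farEdge W β T v c d = 0 := if_neg fun h => h.2.1 (hvc ▸ Reach.refl _ _)
    rw [this, mul_zero, ite_self]
    split_ifs <;> [exact hn T; exact le_rfl]
  by_cases hbd : b = d
  · refine totalExp_mono h0 h1 fun E _ T _ => ?_
    have : (if s(v, b) ∈ T ∧ s(v, c) ∉ E ∧ s(b, d) ∉ E then
        highWeight k T v * farEdge W β T v c d else 0) = 0 := by
      split_ifs with h
      · refine mul_eq_zero_of_right _ (if_neg fun h' => h'.2.1 ?_)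
        exact (Reach.of_mem h.1).trans
          (hbd ▸ (Reach.of_mem (within_subset _ _ h'.1)).symm)
      · rfl
    rw [this]
    split_ifs <;> [exact hn T; exact le_rfl]
  refine le_trans (totalExp_mono h0 h1 fun E hE T hT => ?_) (le_trans (totalExp_switch_le h0 h1 hvc
    hbd (D := D) (F := fun _ T => highWeight k T v * linkEdge W T v b c d) fun _ T => hn T)
    (totalExp_mono h0 h1 fun E hE T hT => ?_))
  · by_cases h : (s(v, b) ∈ T ∧ s(v, c) ∉ E ∧ s(b, d) ∉ E) ∧ s(c, d) ∈ within W T ∧ ¬ Reach T v c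
    · obtain ⟨⟨a1, a2, a3⟩, b1, b2⟩ := h
      obtain ⟨b3, b4, b5⟩ := mk_mem_within.1 b1
      have hswE : Switchable v b c d E := ⟨hT a1, hT b3, a2, a3, ne_of_mem_edgeSets hE (hT a1),
        ne_of_mem_edgeSets hE (hT b3), hvc, hbd⟩
      have hswT : Switchable v b c d T := ⟨a1, b3, fun h => a2 (hT h), fun h => a3 (hT h),
        hswE.hvb, hswE.hcd, hvc, hbd⟩
      rw [if_pos ⟨a1, a2, a3⟩, if_pos ⟨a1, b3, a2, a3⟩]
      have hw : highWeight k (switch v b c d T) v = highWeight k T v := by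
        unfold highWeight highInd
        rw [hswT.edgeDeg_switch]
      rw [hw]
      refine mul_le_mul_of_nonneg_left ?_ highWeight_nonneg
      refine le_trans (b := 1) (by unfold farEdge; split_ifs <;> norm_num) ?_
      unfold linkEdge
      by_cases hb : b ∈ W
      · rw [if_pos]
        · exact le_add_of_nonneg_right (by positivity)
        · refine ⟨mem_erase.2 ⟨hswE.vc_ne_bd.symm, mk_mem_within.2
            ⟨mk_right_mem_switch, hb, b5⟩⟩, fun hr => b2 ?_⟩
          exact (Reach.of_mem a1).trans ((hr.mono
            (within_switch_erase_subset.trans (within_subset _ _))).trans (Reach.of_mem b3).symm)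
      · rw [if_pos (c := b ∉ W ∧ _)]
        · exact le_add_of_nonneg_left (by positivity)
        · refine ⟨hb, b5, mem_filter.2 ⟨mk_right_mem_switch, fun z hz hze => ?_⟩⟩
          rw [mem_singleton.1 hz] at hze
          rcases Sym2.mem_iff.1 hze with h | h
          · exact hswE.hvb h
          · exact hswE.hvd h
    · have : (if s(v, b) ∈ T ∧ s(v, c) ∉ E ∧ s(b, d) ∉ E then
          highWeight k T v * farEdge W β T v c d else 0) = 0 := by
        split_ifs with h'
        · exact mul_eq_zero_of_right _ (if_neg fun h2 => h ⟨h', h2.1, h2.2.1⟩)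
        · rfl
      rw [this]
      split_ifs <;> [exact hn _; exact le_rfl]
  · split_ifs with h2 h3
    · exact le_rfl
    · exact absurd h2.1 h3
    · exact hn _
    · exact le_rfl

/-- The edges with exactly one end in `W`. -/
def crossing (W : Finset V) (E : Finset (Sym2 V)) : Finset (Sym2 V) :=
  {e ∈ E | ∃ b ∉ W, ∃ d ∈ W, e = s(b, d)}

theorem card_crossing_le (W : Finset V) (E : Finset (Sym2 V)) :
    #(crossing W E) ≤ ∑ x ∈ Wᶜ, edgeDeg E x := by
  have h : ∑ x ∈ Wᶜ, edgeDeg E x = ∑ e ∈ E, #{x | x ∈ e ∧ x ∉ W} := by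
    refine Eq.trans (sum_congr ?_ fun _ _ => rfl) ((sum_edgeDeg_filter E fun x => x ∉ W).trans
      (sum_congr rfl fun e _ => by congr))
    ext
    simp
  rw [h, crossing, card_filter]
  refine sum_le_sum fun e _ => ?_
  split_ifs with h
  · obtain ⟨b, hb, d, -, rfl⟩ := h
    exact card_pos.2 ⟨b, by simp [hb]⟩
  · exact Nat.zero_le _

theorem sum_linkEdge_le (W : Finset V) (T : Finset (Sym2 V)) (v c : V) :
    ∑ b, ∑ d, linkEdge W T v b c d ≤ 2 * #W + #(crossing W (avoiding {v} T)) := by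
  unfold linkEdge
  simp only [sum_add_distrib]
  refine add_le_add (sum_bridges_le ?_) ?_
  · have h : within W (within W T) = within W T := by
      rw [← within_inter (within_subset W T), Finset.inter_self]
    rw [← within_inter (erase_subset _ _), h]
    exact inter_eq_left.2 (erase_subset _ _)
  · rw [← Fintype.sum_prod_type' (f := fun b d =>
      if b ∉ W ∧ d ∈ W ∧ s(b, d) ∈ avoiding {v} T then (1 : ℝ) else 0), sum_boole, Nat.cast_le]
    refine card_le_card_of_injOn (fun q => s(q.1, q.2)) (fun q hq => ?_) fun q hq q' hq' h => ?_
    · obtain ⟨-, h1, h2, h3⟩ := mem_filter.1 (mem_coe.1 hq)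
      exact mem_filter.2 ⟨h3, q.1, h1, q.2, h2, rfl⟩
    · obtain ⟨-, h1, h2, -⟩ := mem_filter.1 (mem_coe.1 hq)
      obtain ⟨-, h1', h2', -⟩ := mem_filter.1 (mem_coe.1 hq')
      rcases Sym2.eq_iff.1 h with ⟨a, a'⟩ | ⟨a, a'⟩
      · exact Prod.ext a a'
      · exact absurd (a ▸ h2') h1

theorem highInd_inter_touching {Z : Finset V} (hT : T ⊆ E) (hv : v ∈ Z) :
    highInd k (T ∩ touching Z E) v = highInd k T v := by
  unfold highInd
  rw [edgeDeg_inter_touching hT hv]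

/-- The degree of v and the crossing edges that avoid v involve disjoint edge sets, so the
expectation factorizes; this is why `linkEdge` counts only crossing edges away from v. -/
theorem bernExp_highInd_mul_crossing_le (h0 : 0 ≤ p) (h1 : p ≤ 1) :
    bernExp p E (fun T => highInd k T v * #(crossing W (avoiding {v} T))) ≤
      bernExp p E (fun T => highInd k T v) * (p * ∑ x ∈ Wᶜ, (edgeDeg E x : ℝ)) := by
  have hdis : Disjoint (touching {v} E) (crossing W (avoiding {v} E)) :=
    disjoint_of_subset_right (filter_subset _ _) (disjoint_touching_avoiding {v} E E)
  have hsub : crossing W (avoiding {v} E) ⊆ E := (filter_subset _ _).trans (avoiding_subset {v} E)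
  have h := bernExp_mul_of_disjoint (p := p) (touching_subset {v} E) hsub hdis
    (fun T => highInd k T v) (fun T => (#T : ℝ))
  have e1 : bernExp p E (fun T => highInd k T v * #(crossing W (avoiding {v} T))) =
      bernExp p (touching {v} E) (fun T => highInd k T v) *
        (p * #(crossing W (avoiding {v} E))) := by
    rw [← bernExp_card, ← h]
    refine bernExp_congr fun T hT => ?_
    rw [highInd_inter_touching hT (mem_singleton_self v)]
    congr 3
    ext e
    simp only [crossing, avoiding, mem_filter, Finset.mem_inter]
    exact ⟨fun h => ⟨h.1.1, ⟨hT h.1.1, h.1.2⟩, h.2⟩, fun h => ⟨⟨h.1, h.2.1.2⟩, h.2.2⟩⟩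
  rw [e1, ← bernExp_inter (touching_subset {v} E),
    bernExp_congr fun T hT => highInd_inter_touching hT (mem_singleton_self v)]
  have h2 : (#(crossing W (avoiding {v} E)) : ℝ) ≤ ∑ x ∈ Wᶜ, (edgeDeg E x : ℝ) := by
    refine le_trans (Nat.cast_le.2 ((card_le_card ?_).trans (card_crossing_le W E)))
      (le_of_eq (by push_cast; rfl))
    exact filter_subset_filter _ (avoiding_subset _ _)
  exact mul_le_mul_of_nonneg_left (mul_le_mul_of_nonneg_left h2 h0)
    (bernExp_nonneg h0 h1 fun T _ => highInd_nonneg)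

theorem edgeDeg_sdiff_of_forall {M : Finset (Sym2 V)} (h : ∀ e ∈ M, v ∉ e) :
    edgeDeg (T \ M) v = edgeDeg T v := by
  unfold edgeDeg
  congr 1
  ext e
  simp only [mem_filter, Finset.mem_sdiff]
  exact ⟨fun h' => ⟨h'.1.1, h'.2⟩, fun h' => ⟨⟨h'.1, fun he => h e he h'.2⟩, h'.2⟩⟩

/-- The total number of edges in large components that are not joined to a vertex of degree at
least `k`, summed over these vertices. -/
theorem totalExp_farEdge_le (h0 : 0 ≤ p) (h1 : p ≤ 1) (hk : 1 ≤ k) (hβ : 1 < β) {κ : ℝ}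
    (hκ : ∀ E ∈ edgeSets D, (#(within W E) : ℝ) ≤ κ) :
    totalExp p D (fun _ T => ∑ v, highInd k T v * ∑ c, ∑ d, farEdge W β T v c d) ≤
      (6 * #W + 2 * (#W * (p * κ) / (β - 1)) + p * ∑ x ∈ Wᶜ, (D x : ℝ)) *
        totalExp p D (fun _ T => ∑ v, highInd k T v) := by
  set B : ℝ := 2 * #W + #W * (p * κ) / (β - 1) with hB
  have hpt : ∀ E ∈ edgeSets D, ∀ T ⊆ E,
      ∑ v, highInd k T v * ∑ c, ∑ d, farEdge W β T v c d ≤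
        (∑ v, ∑ b, ∑ c, ∑ d, if s(v, b) ∈ T ∧ s(v, c) ∉ E ∧ s(b, d) ∉ E then
          highWeight k T v * farEdge W β T v c d else 0) +
        ((∑ v, highInd k T v * ∑ c, ∑ d, if s(v, c) ∈ E then farEdge W β T v c d else 0) +
        ∑ v, ∑ b, (if s(v, b) ∈ T then highWeight k T v else 0) *
          ∑ c, ∑ d, if s(b, c) ∈ E then farEdge W β T v c d else 0) := by
    intro E _ T _
    rw [← sum_add_distrib, ← sum_add_distrib]
    refine sum_le_sum fun v _ => ?_
    rw [← sum_mem_mul_highWeight hk, sum_mul, sum_mul, ← sum_add_distrib, ← sum_add_distrib]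
    refine sum_le_sum fun b _ => ?_
    by_cases hvb : s(v, b) ∈ T
    · simp only [hvb, if_true, true_and]
      -- Exchanging c and d turns a switch blocked by bd into one blocked by bc, so both kinds of
      -- blocking concern the vertex c.
      have hsw : ∑ c, ∑ d, (if s(b, c) ∈ E then farEdge W β T v c d else 0) =
          ∑ c, ∑ d, (if s(b, d) ∈ E then farEdge W β T v c d else 0) := by
        rw [sum_comm]
        simp only [farEdge_symm]
      rw [hsw, mul_sum, mul_sum, mul_sum, ← sum_add_distrib, ← sum_add_distrib]
      refine sum_le_sum fun c _ => ?_
      rw [mul_sum, mul_sum, mul_sum, ← sum_add_distrib, ← sum_add_distrib]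
      refine sum_le_sum fun d _ => ?_
      have hx : 0 ≤ highWeight k T v * farEdge W β T v c d :=
        mul_nonneg highWeight_nonneg farEdge_nonneg
      by_cases e1 : s(v, c) ∈ E <;> by_cases e2 : s(b, d) ∈ E <;> simp [e1, e2, hx]
    · simp [hvb]
  refine (totalExp_mono h0 h1 hpt).trans ?_
  rw [totalExp_add, totalExp_add]
  have s1 : totalExp p D (fun E T => ∑ v, ∑ b, ∑ c, ∑ d,
      if s(v, b) ∈ T ∧ s(v, c) ∉ E ∧ s(b, d) ∉ E then
        highWeight k T v * farEdge W β T v c d else 0) ≤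
      (2 * #W + p * ∑ x ∈ Wᶜ, (D x : ℝ)) * totalExp p D (fun _ T => ∑ v, highInd k T v) := by
    have e1 : totalExp p D (fun E T => ∑ v, ∑ b, ∑ c, ∑ d,
        if s(v, b) ∈ T ∧ s(v, c) ∉ E ∧ s(b, d) ∉ E then
          highWeight k T v * farEdge W β T v c d else 0) ≤
        totalExp p D (fun _ T => ∑ v, ∑ b, ∑ c, ∑ d, if s(v, c) ∈ T then
          highWeight k T v * linkEdge W T v b c d else 0) := by
      simp only [totalExp_sum]
      exact sum_le_sum fun v _ => sum_le_sum fun b _ => sum_le_sum fun c _ => sum_le_sum fun d _ =>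
        totalExp_farEdge_switch_le h0 h1
    refine e1.trans ?_
    rw [← totalExp_const_mul]
    unfold totalExp
    refine sum_le_sum fun E hE => ?_
    have e2 : ∀ T ⊆ E, (∑ v, ∑ b, ∑ c, ∑ d, if s(v, c) ∈ T then
        highWeight k T v * linkEdge W T v b c d else 0) ≤
        ∑ v, (2 * #W * highInd k T v + highInd k T v * #(crossing W (avoiding {v} T))) := by
      intro T _
      refine sum_le_sum fun v _ => ?_
      rw [sum_comm, mul_comm, ← mul_add, ← sum_mem_mul_highWeight hk, sum_mul]
      refine sum_le_sum fun c _ => ?_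
      by_cases hc : s(v, c) ∈ T
      · simp only [hc, if_true]
        simp only [← mul_sum]
        exact mul_le_mul_of_nonneg_left (sum_linkEdge_le W T v c) highWeight_nonneg
      · simp [hc]
    refine (bernExp_mono h0 h1 e2).trans ?_
    rw [bernExp_const_mul, bernExp_sum, bernExp_sum, mul_sum]
    refine sum_le_sum fun v _ => ?_
    rw [bernExp_add, bernExp_const_mul, add_mul]
    refine add_le_add le_rfl ?_
    have := bernExp_highInd_mul_crossing_le (E := E) (W := W) (k := k) (v := v) h0 h1
    simp only [(mem_filter.1 hE).2.2] at this
    rw [mul_comm (p * _)]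
    exact this
  have s2 : totalExp p D (fun E T => ∑ v, highInd k T v *
      ∑ c, ∑ d, if s(v, c) ∈ E then farEdge W β T v c d else 0) ≤
      B * totalExp p D (fun _ T => ∑ v, highInd k T v) := by
    rw [← totalExp_const_mul]
    unfold totalExp
    refine sum_le_sum fun E hE => ?_
    rw [bernExp_const_mul, bernExp_sum, bernExp_sum, mul_sum]
    refine sum_le_sum fun v _ => ?_
    rw [mul_comm]
    exact bernExp_far_at_le h0 h1 hβ (hκ E hE) (mem_singleton_self v) _
      (fun T => highInd_nonneg) (fun T M _ => highInd_mono sdiff_subset)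
      (fun T hT => highInd_inter_touching hT (mem_singleton_self v))
      (fun T _ _ z hz => (mem_singleton.1 hz) ▸ Reach.refl _ _)
  have s3 : totalExp p D (fun E T => ∑ v, ∑ b, (if s(v, b) ∈ T then highWeight k T v else 0) *
      ∑ c, ∑ d, if s(b, c) ∈ E then farEdge W β T v c d else 0) ≤
      B * totalExp p D (fun _ T => ∑ v, highInd k T v) := by
    rw [← totalExp_const_mul]
    unfold totalExp
    refine sum_le_sum fun E hE => ?_
    rw [bernExp_const_mul, bernExp_sum, bernExp_sum, mul_sum]
    refine sum_le_sum fun v _ => ?_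
    have hs : bernExp p E (fun T => highInd k T v) =
        ∑ b, bernExp p E (fun T => if s(v, b) ∈ T then highWeight k T v else 0) := by
      rw [← bernExp_sum]
      exact bernExp_congr fun T _ => (sum_mem_mul_highWeight hk).symm
    rw [bernExp_sum, hs, mul_sum]
    refine sum_le_sum fun b _ => ?_
    rw [mul_comm]
    by_cases hvb : s(v, b) ∈ E
    · have hne := ne_of_mem_edgeSets hE hvb
      have hvZ : v ∈ ({v, b} : Finset V) := by simp
      have hwt : ∀ T ⊆ E, highWeight k (T ∩ touching {v, b} E) v = highWeight k T v :=
        fun T hT => by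
          unfold highWeight
          rw [highInd_inter_touching hT hvZ, edgeDeg_inter_touching hT hvZ]
      have hvt : s(v, b) ∈ touching {v, b} E :=
        mem_filter.2 ⟨hvb, fun h => h v hvZ (Sym2.mem_mk_left _ _)⟩
      refine bernExp_far_at_le h0 h1 hβ (hκ E hE) (Z := {v, b}) (by simp) _ (fun T => ?_)
        (fun T M hM => ?_) (fun T hT => ?_) (fun T hT hT0 z hz => ?_)
      · split_ifs <;> [exact highWeight_nonneg; exact le_rfl]
      -- The weight 1/deg(v) could increase if edges at v were removed. The edges in M join b to
      -- vertices outside {v, b}, so they affect neither the degree of v nor the edge vb.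
      · have hM' : ∀ e ∈ M, v ∉ e := fun e he hve => by
          obtain ⟨y, hy, rfl⟩ := mem_image.1 (hM he)
          rcases Sym2.mem_iff.1 hve with h | h
          · exact hne h
          · exact (mem_filter.1 hy).2.1 (h ▸ hvZ)
        have hw : highWeight k (T \ M) v = highWeight k T v := by
          unfold highWeight highInd
          rw [edgeDeg_sdiff_of_forall hM']
        have hm : s(v, b) ∈ T \ M ↔ s(v, b) ∈ T := by
          rw [Finset.mem_sdiff]
          exact ⟨fun h => h.1, fun h => ⟨h, fun h' => hM' _ h' (Sym2.mem_mk_left _ _)⟩⟩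
        rw [hw]
        simp only [hm, le_refl]
      · rw [hwt T hT]
        simp only [Finset.mem_inter, hvt, and_true]
      · have hT1 : s(v, b) ∈ T := by
          by_contra h
          exact hT0 (if_neg h)
        rcases Finset.mem_insert.1 hz with rfl | hz
        · exact Reach.refl _ _
        · rw [mem_singleton.1 hz]
          exact Reach.of_mem hT1
    · have hz : ∀ T ⊆ E, (if s(v, b) ∈ T then highWeight k T v else 0) = 0 := fun T hT =>
        if_neg fun h => hvb (hT h)
      rw [bernExp_congr (F' := fun _ => 0) fun T hT => by rw [hz T hT, zero_mul],
        bernExp_congr (F' := fun _ => 0) hz, bernExp_const, zero_mul]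
  calc _ ≤ _ := add_le_add s1 (add_le_add s2 s3)
    _ = _ := by rw [hB]; ring

end FarEdges

/-! ### Second moment of the number of vertices of high degree -/

section Concentration

variable {V : Type*} [DecidableEq V] [Fintype V]
variable {p : ℝ} {D : V → ℕ} {W : Finset V} {E E' T : Finset (Sym2 V)} {u v : V} {k : ℕ}

/-- The probability that a vertex has degree at least `k` in the percolation of `E`. -/
def highProb (p : ℝ) (k : ℕ) (E : Finset (Sym2 V)) (v : V) : ℝ :=
  bernExp p E fun T => highInd k T v

theorem highProb_nonneg (h0 : 0 ≤ p) (h1 : p ≤ 1) : 0 ≤ highProb p k E v :=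
  bernExp_nonneg h0 h1 fun _ _ => highInd_nonneg

theorem card_touching_singleton (T : Finset (Sym2 V)) (v : V) :
    #(touching {v} T) = edgeDeg T v := by
  unfold touching edgeDeg Avoids
  congr 1
  ext e
  simp

theorem edgeDeg_eq_card_inter_touching (hT : T ⊆ E) :
    edgeDeg T v = #(T ∩ touching {v} E) := by
  rw [← card_touching_singleton]
  congr 1
  ext e
  simp only [touching, Finset.mem_inter, mem_filter]
  exact ⟨fun h => ⟨h.1, hT h.1, h.2⟩, fun h => ⟨h.1, h.2.2⟩⟩

theorem highProb_eq_touching : highProb p k E v =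
    bernExp p (touching {v} E) (fun T => if k ≤ #T then 1 else 0) := by
  rw [← bernExp_inter (touching_subset {v} E)]
  refine bernExp_congr fun T hT => ?_
  unfold highInd
  rw [edgeDeg_eq_card_inter_touching hT]

/-- The law of the degree of a vertex depends only on its degree in the host graph. -/
theorem highProb_congr (h : edgeDeg E v = edgeDeg E' v) : highProb p k E v = highProb p k E' v := by
  rw [highProb_eq_touching, highProb_eq_touching]
  refine bernExp_card_eq (fun m => if k ≤ m then 1 else 0) ?_
  rw [card_touching_singleton, card_touching_singleton, h]

theorem bernExp_edgeDeg_sq :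
    bernExp p E (fun T => ((edgeDeg T v : ℝ) - p * edgeDeg E v) ^ 2) =
      p * (1 - p) * edgeDeg E v := by
  rw [← card_touching_singleton E v, ← bernExp_card_sq, ← bernExp_inter (touching_subset {v} E)]
  exact bernExp_congr fun T hT => by rw [edgeDeg_eq_card_inter_touching hT]

/-- Chebyshev: with mean m ≥ 8, variance at most m and threshold k ≤ m/2, failure has probability at
most 4/m ≤ 1/2. -/
theorem half_le_highProb (h0 : 0 ≤ p) (h1 : p ≤ 1) (hk : 2 * (k : ℝ) ≤ p * edgeDeg E v)
    (h8 : 8 ≤ p * edgeDeg E v) : 1 / 2 ≤ highProb p k E v := by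
  set m : ℝ := p * edgeDeg E v with hm
  have hvar : bernExp p E (fun T => ((edgeDeg T v : ℝ) - m) ^ 2) ≤ m := by
    rw [hm, bernExp_edgeDeg_sq]
    nlinarith
  have h : (1 : ℝ) - highProb p k E v ≤ 4 / m ^ 2 * m := by
    rw [← bernExp_const (p := p) (A := E) (1 : ℝ), highProb, ← bernExp_sub]
    refine le_trans (bernExp_mono h0 h1 (F' := fun T => 4 / m ^ 2 * ((edgeDeg T v : ℝ) - m) ^ 2)
      fun T _ => ?_) ?_
    · unfold highInd
      split_ifs with h
      · rw [sub_self]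
        positivity
      · rw [sub_zero, div_mul_eq_mul_div, one_le_div (by positivity)]
        have : (edgeDeg T v : ℝ) ≤ k := by exact_mod_cast (not_le.1 h).le
        nlinarith
    · rw [bernExp_const_mul]
      exact mul_le_mul_of_nonneg_left hvar (by positivity)
  have h2 : 4 / m ^ 2 * m ≤ 1 / 2 := by
    have hm0 : 0 < m := by linarith
    rw [show 4 / m ^ 2 * m = 4 / m by field_simp, div_le_div_iff₀ hm0 (by norm_num)]
    linarith
  linarith

/-- Only the edge uv influences both degrees. Ignoring it at u makes the two events independent, and
this matters only if uv is present and u has degree exactly k. -/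
theorem bernExp_highInd_mul_le (h0 : 0 ≤ p) (h1 : p ≤ 1) (huv : u ≠ v) :
    bernExp p E (fun T => highInd k T u * highInd k T v) ≤
      highProb p k E u * highProb p k E v +
        bernExp p E (fun T => if s(u, v) ∈ T ∧ edgeDeg T u = k then 1 else 0) := by
  set A := (touching {u} E).erase s(u, v) with hA
  have hAE : A ⊆ E := (erase_subset _ _).trans (touching_subset _ _)
  have hdis : Disjoint A (touching {v} E) := by
    refine disjoint_left.2 fun e he he' => ?_
    obtain ⟨hne, he⟩ := mem_erase.1 he
    have a1 : u ∈ e := by simpa [Avoids] using (mem_filter.1 he).2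
    have a2 : v ∈ e := by simpa [Avoids] using (mem_filter.1 he').2
    exact hne ((Sym2.mem_and_mem_iff huv).1 ⟨a1, a2⟩)
  have hprod := bernExp_mul_of_disjoint (p := p) hAE (touching_subset {v} E) hdis
    (fun T => highInd k T u) (fun T => highInd k T v)
  have e1 : bernExp p A (fun T => highInd k T u) ≤ highProb p k E u := by
    rw [← bernExp_inter hAE]
    exact bernExp_mono h0 h1 fun T _ => highInd_mono Finset.inter_subset_left
  have e2 : bernExp p (touching {v} E) (fun T => highInd k T v) = highProb p k E v := by
    rw [← bernExp_inter (touching_subset {v} E)]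
    exact bernExp_congr fun T hT => highInd_inter_touching hT (mem_singleton_self v)
  refine le_trans (b := bernExp p E (fun T => highInd k (T ∩ A) u *
    highInd k (T ∩ touching {v} E) v + if s(u, v) ∈ T ∧ edgeDeg T u = k then 1 else 0)) ?_ ?_
  · refine bernExp_mono h0 h1 fun T hT => ?_
    rw [highInd_inter_touching hT (mem_singleton_self v)]
    have hTA : edgeDeg T u ≤ edgeDeg (T ∩ A) u + if s(u, v) ∈ T then 1 else 0 := by
      have hsub : ({e ∈ T | u ∈ e} : Finset _) ⊆ {e ∈ T ∩ A | u ∈ e} ∪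
          if s(u, v) ∈ T then {s(u, v)} else ∅ := fun e he => by
        obtain ⟨he, hu⟩ := mem_filter.1 he
        by_cases hev : e = s(u, v)
        · subst hev
          simp [he]
        · refine mem_union_left _ (mem_filter.2 ⟨Finset.mem_inter.2 ⟨he, mem_erase.2 ⟨hev,
            mem_filter.2 ⟨hT he, fun h => h u (mem_singleton_self u) hu⟩⟩⟩, hu⟩)
      refine le_trans (card_le_card hsub) (le_trans (card_union_le _ _) (add_le_add le_rfl ?_))
      split_ifs <;> simp
    have hv0 := highInd_nonneg (k := k) (T := T) (v := v)
    have hv1 : highInd k T v ≤ 1 := by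
      unfold highInd
      split_ifs <;> norm_num
    have hu : highInd k T u ≤ highInd k (T ∩ A) u +
        if s(u, v) ∈ T ∧ edgeDeg T u = k then 1 else 0 := by
      unfold highInd
      by_cases a1 : k ≤ edgeDeg T u
      · by_cases a2 : k ≤ edgeDeg (T ∩ A) u
        · rw [if_pos a1, if_pos a2]
          split_ifs <;> norm_num
        · have a3 : s(u, v) ∈ T := by
            by_contra h
            rw [if_neg h] at hTA
            omega
          rw [if_pos a3] at hTA
          rw [if_pos a1, if_neg a2, if_pos ⟨a3, by omega⟩]
          norm_num
      · rw [if_neg a1]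
        split_ifs <;> norm_num
    have hi0 : (0 : ℝ) ≤ if s(u, v) ∈ T ∧ edgeDeg T u = k then 1 else 0 := by
      split_ifs <;> norm_num
    nlinarith
  · rw [bernExp_add, hprod, e2]
    exact add_le_add (mul_le_mul_of_nonneg_right e1 (highProb_nonneg h0 h1)) le_rfl

/-- The variance of the number of vertices of degree at least `k`. -/
theorem bernExp_sum_highInd_sq_le (h0 : 0 ≤ p) (h1 : p ≤ 1) :
    bernExp p E (fun T => ((∑ v, highInd k T v) - ∑ v, highProb p k E v) ^ 2) ≤
      (k + 1) * ∑ v, highProb p k E v := by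
  set Q := ∑ v, highProb p k E v with hQ
  have hmean : bernExp p E (fun T => ∑ v, highInd k T v) = Q := by
    rw [bernExp_sum]
    rfl
  have hsq : bernExp p E (fun T => (∑ v, highInd k T v) ^ 2) ≤ Q ^ 2 + (k + 1) * Q := by
    have e1 : bernExp p E (fun T => (∑ v, highInd k T v) ^ 2) =
        ∑ u, ∑ v, bernExp p E (fun T => highInd k T u * highInd k T v) := by
      simp only [← bernExp_sum]
      refine bernExp_congr fun T _ => ?_
      rw [sq, sum_mul_sum]
    have e2 : ∀ u v, bernExp p E (fun T => highInd k T u * highInd k T v) ≤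
        highProb p k E u * highProb p k E v + ((if u = v then highProb p k E u else 0) +
          bernExp p E (fun T => if s(u, v) ∈ T ∧ edgeDeg T u = k then 1 else 0)) := by
      intro u v
      have n1 : 0 ≤ bernExp p E
          (fun T => if s(u, v) ∈ T ∧ edgeDeg T u = k then (1 : ℝ) else 0) :=
        bernExp_nonneg h0 h1 fun T _ => by split_ifs <;> norm_num
      by_cases huv : u = v
      · subst huv
        have : bernExp p E (fun T => highInd k T u * highInd k T u) = highProb p k E u := by
          refine bernExp_congr fun T _ => ?_
          unfold highInd
          split_ifs <;> norm_num
        rw [this, if_pos rfl]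
        nlinarith [highProb_nonneg (k := k) (E := E) (v := u) h0 h1]
      · rw [if_neg huv, zero_add]
        exact bernExp_highInd_mul_le h0 h1 huv
    -- A vertex u of degree exactly k has exactly k neighbours v, so this sum is at most k times the
    -- expected number of high vertices.
    have e3 : ∑ u, ∑ v, bernExp p E
        (fun T => if s(u, v) ∈ T ∧ edgeDeg T u = k then (1 : ℝ) else 0) ≤ k * Q := by
      rw [hQ, mul_sum]
      refine sum_le_sum fun u _ => ?_
      rw [← bernExp_sum, highProb, ← bernExp_const_mul]
      refine bernExp_mono h0 h1 fun T _ => ?_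
      unfold highInd
      by_cases hd : edgeDeg T u = k
      · simp only [hd, and_true]
        rw [sum_mk_mem, hd]
        simp
      · simp only [hd, and_false, if_false, sum_const_zero]
        positivity
    rw [e1]
    refine le_trans (sum_le_sum fun u _ => sum_le_sum fun v _ => e2 u v) ?_
    simp only [sum_add_distrib]
    rw [← sum_mul_sum, ← hQ]
    simp only [sum_ite_eq, mem_univ, if_true]
    rw [← hQ]
    nlinarith
  have hexp : bernExp p E (fun T => ((∑ v, highInd k T v) - Q) ^ 2) =
      bernExp p E (fun T => (∑ v, highInd k T v) ^ 2) - Q ^ 2 := by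
    have : bernExp p E (fun T => ((∑ v, highInd k T v) - Q) ^ 2) =
        bernExp p E (fun T => ((∑ v, highInd k T v) ^ 2 - 2 * Q * ∑ v, highInd k T v) + Q ^ 2) :=
      bernExp_congr fun T _ => by ring
    rw [this, bernExp_add, bernExp_sub, bernExp_const_mul, bernExp_const, hmean]
    ring
  rw [hexp]
  linarith

end Concentration

/-! ### Combining the moment bounds: the giant component -/

section GiantComponent

variable {V : Type*} [DecidableEq V] [Fintype V]
variable {p β : ℝ} {D : V → ℕ} {W : Finset V} {E T L : Finset (Sym2 V)} {k : ℕ}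

theorem card_within_le (W : Finset V) (E : Finset (Sym2 V)) :
    #(within W E) ≤ ∑ x ∈ W, edgeDeg E x := by
  refine (card_le_sum_edgeDeg _).trans ?_
  rw [← sum_subset (subset_univ W) fun x _ hx => edgeDeg_eq_zero
    (by rw [← within_inter (within_subset W E), Finset.inter_self]) hx]
  exact sum_le_sum fun x _ => edgeDeg_mono (within_subset _ _) x

theorem sum_edgeDeg_le_within (W : Finset V) (E : Finset (Sym2 V)) :
    ∑ x ∈ W, edgeDeg E x ≤ 2 * #(within W E) + ∑ x ∈ Wᶜ, edgeDeg E x := by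
  have h1 : ∀ x ∈ W, edgeDeg E x ≤ edgeDeg (within W E) x + edgeDeg (crossing W E) x := by
    intro x hx
    unfold edgeDeg
    refine le_trans (card_le_card fun e he => ?_) (card_union_le _ _)
    obtain ⟨he, hxe⟩ := mem_filter.1 he
    by_cases hin : Inside W e
    · exact mem_union_left _ (mem_filter.2 ⟨mem_filter.2 ⟨he, hin⟩, hxe⟩)
    · unfold Inside at hin
      push Not at hin
      obtain ⟨y, hy, hyW⟩ := hin
      have hyx : y ≠ x := fun h => hyW (h ▸ hx)
      exact mem_union_right _ (mem_filter.2 ⟨mem_filter.2 ⟨he, y, hyW, x, hx,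
        (Sym2.mem_and_mem_iff hyx).1 ⟨hy, hxe⟩⟩, hxe⟩)
  have h2 : ∑ x ∈ W, edgeDeg (crossing W E) x ≤ #(crossing W E) := by
    have h := sum_edgeDeg_filter (crossing W E) fun x => x ∈ W
    rw [card_eq_sum_ones]
    refine (Eq.trans (sum_congr (by ext; simp) fun _ _ => rfl) h).trans_le (sum_le_sum ?_)
    intro e he
    obtain ⟨-, b, hb, d, -, rfl⟩ := mem_filter.1 he
    refine (card_le_card (t := {d}) fun x hx => ?_).trans_eq (card_singleton d)
    obtain ⟨hx, hxW⟩ : x ∈ s(b, d) ∧ x ∈ W := by simpa using hx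
    rcases Sym2.mem_iff.1 hx with rfl | rfl
    · exact absurd hxW hb
    · exact mem_singleton_self _
  have h3 : ∑ x ∈ W, edgeDeg (within W E) x ≤ 2 * #(within W E) :=
    (sum_le_sum_of_subset (subset_univ W)).trans (sum_edgeDeg_le _)
  have h4 := card_crossing_le W E
  have h5 := sum_le_sum h1
  rw [sum_add_distrib] at h5
  omega

/-- If there are few separated pairs of edges, then some component has many edges. -/
theorem exists_large_component {μ : ℝ} (hμ : 0 ≤ μ) (hL : μ / 4 ≤ #L)
    (hU : ∑ v, ∑ b, ∑ c, ∑ d, sepPair L v b c d < 3 / 80 * μ ^ 2) :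
    ∃ c, μ / 20 ≤ compSize L c := by
  by_contra hcon
  push Not at hcon
  -- If all components have fewer than μ/20 edges, each vertex reaches degree sum below μ/10. At
  -- least μ/4 - μ/10 = 3μ/20 oriented edges are then separated from it. The total degree is at
  -- least μ/4, whence 3/80 μ² separated pairs.
  have hsum : ∀ v, (#L : ℝ) - μ / 10 ≤
      ∑ c, ∑ d, if s(c, d) ∈ L ∧ ¬ Reach L v c then (1 : ℝ) else 0 := by
    intro v
    have h1 : ∀ c, (∑ d, if s(c, d) ∈ L ∧ ¬ Reach L v c then (1 : ℝ) else 0) =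
        edgeDeg L c - if Reach L v c then (edgeDeg L c : ℝ) else 0 := fun c => by
      by_cases h : Reach L v c
      · simp [h]
      · simp only [h, not_false_iff, and_true, if_false, sub_zero]
        exact sum_mk_mem L c
    simp only [h1]
    rw [sum_sub_distrib, ← sum_filter]
    have h2 : ((∑ x with Reach L v x, edgeDeg L x : ℕ) : ℝ) ≤ 2 * compSize L v := by
      exact_mod_cast sum_edgeDeg_reach_le L v
    have h3 : ((#L : ℕ) : ℝ) ≤ ((∑ x, edgeDeg L x : ℕ) : ℝ) := by
      exact_mod_cast card_le_sum_edgeDeg L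
    push_cast at h2 h3
    have := hcon v
    linarith
  have hU2 : ∑ v, (edgeDeg L v : ℝ) * ((#L : ℝ) - μ / 10) ≤
      ∑ v, ∑ b, ∑ c, ∑ d, sepPair L v b c d := by
    refine sum_le_sum fun v _ => ?_
    rw [← sum_mk_mem, sum_mul]
    refine sum_le_sum fun b _ => ?_
    by_cases h : s(v, b) ∈ L
    · rw [if_pos h, one_mul]
      refine (hsum v).trans (le_of_eq ?_)
      simp only [sepPair, h, true_and]
    · rw [if_neg h, zero_mul]
      exact sum_nonneg fun c _ => sum_nonneg fun d _ => sepPair_nonneg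
  rw [← sum_mul] at hU2
  have h3 : ((#L : ℕ) : ℝ) ≤ ((∑ x, edgeDeg L x : ℕ) : ℝ) := by
    exact_mod_cast card_le_sum_edgeDeg L
  push_cast at h3
  nlinarith

/-- Up to a proportion `ε`, all vertices of degree at least `k` lie in one component, and
there are at least `(1 - ε) Q` of them. -/
def Concentrated (k : ℕ) (ε Q : ℝ) (T : Finset (Sym2 V)) : Prop :=
  (∃ c, (1 - ε) * ∑ v, highInd k T v ≤ ∑ v, if Reach T v c then highInd k T v else 0) ∧
    (1 - ε) * Q ≤ ∑ v, highInd k T v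

/-- Every high vertex outside the large component sees all its edges as far edges, and there are at
least β of them. -/
theorem compSize_mul_le_sum_farEdge {c : V} (hc : β ≤ compSize (within W T) c) :
    (∑ v, if Reach T v c then 0 else highInd k T v) * β ≤
      ∑ v, highInd k T v * ∑ c, ∑ d, farEdge W β T v c d := by
  rw [sum_mul]
  refine sum_le_sum fun v _ => ?_
  split_ifs with hr
  · rw [zero_mul]
    exact mul_nonneg highInd_nonneg
      (sum_nonneg fun c _ => sum_nonneg fun d _ => farEdge_nonneg)
  refine mul_le_mul_of_nonneg_left ?_ highInd_nonneg
  have h1 : ((compSize (within W T) c : ℕ) : ℝ) ≤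
      ((∑ x with Reach (within W T) c x, edgeDeg (within W T) x : ℕ) : ℝ) := by
    exact_mod_cast compSize_le_sum_edgeDeg_reach _ c
  push_cast at h1
  refine (hc.trans h1).trans ?_
  rw [sum_filter]
  refine sum_le_sum fun x _ => ?_
  split_ifs with hx
  · rw [← sum_mk_mem]
    refine sum_le_sum fun d _ => ?_
    split_ifs with hd
    · refine le_of_eq (Eq.symm (if_pos ⟨hd, fun h => hr ?_, ?_⟩))
      · exact h.trans (hx.mono (within_subset _ _)).symm
      · rwa [← compSize_congr hx]
    · exact farEdge_nonneg
  · exact sum_nonneg fun d _ => farEdge_nonneg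

/-- Fewer than (εQμ/40)/(μ/20) = εQ/2 high vertices lie outside the large component, while their
total number is at least (1-ε)Q ≥ Q/2. -/
theorem concentrated_of_lt {μ ε Q : ℝ} (hμ : 0 < μ) (hε1 : ε ≤ 1 / 2) (hQ0 : 0 < Q)
    (hε : 0 < ε) (hL : μ / 4 ≤ #(within W T))
    (hU : ∑ v, ∑ b, ∑ c, ∑ d, sepPair (within W T) v b c d < 3 / 80 * μ ^ 2)
    (hF : ∑ v, highInd k T v * ∑ c, ∑ d, farEdge W (μ / 20) T v c d < ε * Q * μ / 40)
    (hS : (1 - ε) * Q ≤ ∑ v, highInd k T v) : Concentrated k ε Q T := by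
  obtain ⟨c, hc⟩ := exists_large_component hμ.le hL hU
  refine ⟨⟨c, ?_⟩, hS⟩
  have hX := (compSize_mul_le_sum_farEdge (k := k) hc).trans_lt hF
  have hSX : ∑ v, highInd k T v = (∑ v, if Reach T v c then highInd k T v else 0) +
      ∑ v, if Reach T v c then 0 else highInd k T v := by
    rw [← sum_add_distrib]
    exact sum_congr rfl fun v _ => by split_ifs <;> simp
  generalize ∑ v, (if Reach T v c then 0 else highInd k T v) = X at *
  generalize ∑ v, (if Reach T v c then highInd k T v else 0) = Y at *
  generalize ∑ v, highInd k T v = S at *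
  have hX2 : X < ε * Q / 2 := by
    have : X * (μ / 20) < ε * Q / 2 * (μ / 20) := by linarith
    exact lt_of_mul_lt_mul_right this (by positivity)
  have hQS : Q / 2 ≤ S := by nlinarith
  nlinarith

/-- If the conclusion fails, one of the four conditions fails and its term is at least 1. The
constant 144 is (1/3 - 1/4)⁻², and the others are the reciprocals of the thresholds. -/
theorem indicator_le_markov_sum {μ ε Q m a U F S : ℝ} (hμ : 0 < μ) (hε : 0 < ε) (hQ : 0 < Q)
    (hm : μ / 3 ≤ m) (hU : 0 ≤ U) (hF : 0 ≤ F)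
    (P : Prop) [Decidable P]
    (h : μ / 4 ≤ a → U < 3 / 80 * μ ^ 2 → F < ε * Q * μ / 40 → (1 - ε) * Q ≤ S → P) :
    (if P then 0 else 1) ≤ 144 / μ ^ 2 * (a - m) ^ 2 + (80 / (3 * μ ^ 2) * U +
      (40 / (ε * Q * μ) * F + 1 / (ε * Q) ^ 2 * (S - Q) ^ 2)) := by
  have n1 : 0 ≤ 144 / μ ^ 2 * (a - m) ^ 2 := by positivity
  have n2 : 0 ≤ 80 / (3 * μ ^ 2) * U := by positivity
  have n3 : 0 ≤ 40 / (ε * Q * μ) * F := by positivity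
  have n4 : 0 ≤ 1 / (ε * Q) ^ 2 * (S - Q) ^ 2 := by positivity
  split_ifs with hP
  · linarith
  by_contra hlt
  push Not at hlt
  apply hP
  have l1 : 144 / μ ^ 2 * (a - m) ^ 2 < 1 := by linarith
  have l2 : 80 / (3 * μ ^ 2) * U < 1 := by linarith
  have l3 : 40 / (ε * Q * μ) * F < 1 := by linarith
  have l4 : 1 / (ε * Q) ^ 2 * (S - Q) ^ 2 < 1 := by linarith
  rw [div_mul_eq_mul_div, div_lt_one (by positivity)] at l1 l2 l3 l4
  refine h ?_ (by linarith) (by linarith) ?_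
  · by_contra hcon
    push Not at hcon
    nlinarith
  · by_contra hcon
    push Not at hcon
    have : 0 < ε * Q := by positivity
    nlinarith

theorem totalExp_not_concentrated_le (h0 : 0 ≤ p) (h1 : p ≤ 1) (hk : 1 ≤ k) {μ R ε Q : ℝ}
    (hμ : μ = p * ∑ x ∈ W, (D x : ℝ)) (hμ40 : 40 ≤ μ) (hW : R * #W ≤ μ)
    (hWc : R * (p * ∑ x ∈ Wᶜ, (D x : ℝ)) ≤ μ) (hR : 4 ≤ R) (hRμ : R ≤ μ) (hε : 0 < ε)
    (hε1 : ε ≤ 1 / 2) (hQ : ∀ E ∈ edgeSets D, ∑ v, highProb p k E v = Q) (hQ0 : 0 < Q) :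
    totalExp p D (fun _ T => if Concentrated k ε Q T then 0 else 1) ≤
      #(edgeSets D) * (1000 / R + 3480 / (ε * R) + (k + 1) / (ε ^ 2 * Q)) := by
  have hμ0 : 0 < μ := by linarith
  have hR0 : 0 < R := by linarith
  set ρ := p * ∑ x ∈ Wᶜ, (D x : ℝ) with hρ
  have hw : (#W : ℝ) ≤ μ / R := by rw [le_div_iff₀ hR0]; linarith
  have hρ' : ρ ≤ μ / R := by rw [le_div_iff₀ hR0]; linarith
  have hw0 : (0 : ℝ) ≤ #W := Nat.cast_nonneg _
  have hκ : ∀ E ∈ edgeSets D, (#(within W E) : ℝ) ≤ ∑ x ∈ W, (D x : ℝ) := fun E hE => by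
    have := card_within_le W E
    simp only [(mem_filter.1 hE).2.2] at this
    exact_mod_cast this
  have hlow : ∀ E ∈ edgeSets D, μ / 3 ≤ p * #(within W E) := fun E hE => by
    have := sum_edgeDeg_le_within W E
    simp only [(mem_filter.1 hE).2.2] at this
    have h2 : ∑ x ∈ W, (D x : ℝ) ≤ 2 * #(within W E) + ∑ x ∈ Wᶜ, (D x : ℝ) := by
      exact_mod_cast this
    have h3 := mul_le_mul_of_nonneg_left h2 h0
    rw [mul_add, ← hμ, ← hρ] at h3
    have h4 : ρ ≤ μ / 4 := hρ'.trans (by gcongr)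
    linarith
  have hpt : ∀ E ∈ edgeSets D, ∀ T ⊆ E, (if Concentrated k ε Q T then (0 : ℝ) else 1) ≤
      144 / μ ^ 2 * ((#(T ∩ within W E) : ℝ) - p * #(within W E)) ^ 2 +
      (80 / (3 * μ ^ 2) * (∑ v, ∑ b, ∑ c, ∑ d, sepPair (within W T) v b c d) +
      (40 / (ε * Q * μ) * (∑ v, highInd k T v * ∑ c, ∑ d, farEdge W (μ / 20) T v c d) +
      1 / (ε * Q) ^ 2 * ((∑ v, highInd k T v) - Q) ^ 2)) := by
    intro E hE T hT
    have nU : 0 ≤ ∑ v, ∑ b, ∑ c, ∑ d, sepPair (within W T) v b c d :=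
      sum_nonneg fun v _ => sum_nonneg fun b _ => sum_nonneg fun c _ =>
        sum_nonneg fun d _ => sepPair_nonneg
    have nF : 0 ≤ ∑ v, highInd k T v * ∑ c, ∑ d, farEdge W (μ / 20) T v c d :=
      sum_nonneg fun v _ => mul_nonneg highInd_nonneg
        (sum_nonneg fun c _ => sum_nonneg fun d _ => farEdge_nonneg)
    refine indicator_le_markov_sum hμ0 hε hQ0 (hlow E hE) nU nF _ fun hL => ?_
    rw [within_inter hT] at hL
    exact concentrated_of_lt hμ0 hε1 hQ0 hε hL
  refine (totalExp_mono h0 h1 hpt).trans ?_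
  rw [totalExp_add, totalExp_add, totalExp_add]
  simp only [totalExp_const_mul]
  have hN : (0 : ℝ) ≤ #(edgeSets D) := Nat.cast_nonneg _
  have b1 : totalExp p D (fun E T => ((#(T ∩ within W E) : ℝ) - p * #(within W E)) ^ 2) ≤
      #(edgeSets D) * μ := by
    refine totalExp_le_of_forall fun E hE => ?_
    rw [bernExp_inter (within_subset W E) (fun T => ((#T : ℝ) - p * #(within W E)) ^ 2),
      bernExp_card_sq, hμ]
    have h2 := hκ E hE
    have h3 : (0 : ℝ) ≤ p * #(within W E) := by positivity
    nlinarith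
  have b2 := totalExp_sepPair_le (W := W) (D := D) h0 h1 hκ
  rw [← hμ] at b2
  have b3 := totalExp_farEdge_le (W := W) (D := D) h0 h1 hk (β := μ / 20) (by linarith) hκ
  rw [← hμ, ← hρ] at b3
  have hQt : totalExp p D (fun _ T => ∑ v, highInd k T v) = #(edgeSets D) * Q := by
    rw [← nsmul_eq_mul, ← sum_const]
    refine sum_congr rfl fun E hE => ?_
    rw [bernExp_sum, ← hQ E hE]
    rfl
  rw [hQt] at b3
  have b4 : totalExp p D (fun _ T => ((∑ v, highInd k T v) - Q) ^ 2) ≤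
      #(edgeSets D) * ((k + 1) * Q) := by
    refine totalExp_le_of_forall fun E hE => ?_
    have := bernExp_sum_highInd_sq_le (E := E) (k := k) h0 h1
    rwa [hQ E hE] at this
  -- Since μ ≥ 40, the denominator is at least μ/40; the constant is 6 + 2·40 + 1.
  have c3 : 6 * (#W : ℝ) + 2 * (#W * μ / (μ / 20 - 1)) + ρ ≤ 87 * (μ / R) := by
    have : #W * μ / (μ / 20 - 1) ≤ 40 * #W := by
      rw [div_le_iff₀ (by linarith)]
      nlinarith
    linarith
  have d1 : 144 / μ ^ 2 * (#(edgeSets D) * μ) ≤ #(edgeSets D) * (144 / R) := by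
    rw [show 144 / μ ^ 2 * (#(edgeSets D) * μ) = #(edgeSets D) * (144 / μ) by field_simp]
    gcongr
  have d2 : 80 / (3 * μ ^ 2) * (#(edgeSets D) * (32 * #W * μ)) ≤
      #(edgeSets D) * (2560 / (3 * R)) := by
    calc _ ≤ 80 / (3 * μ ^ 2) * (#(edgeSets D) * (32 * (μ / R) * μ)) := by gcongr
      _ = _ := by field_simp; ring
  have d3 : 40 / (ε * Q * μ) * ((6 * (#W : ℝ) + 2 * (#W * μ / (μ / 20 - 1)) + ρ) *
      (#(edgeSets D) * Q)) ≤ #(edgeSets D) * (3480 / (ε * R)) := by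
    calc _ ≤ 40 / (ε * Q * μ) * (87 * (μ / R) * (#(edgeSets D) * Q)) := by gcongr
      _ = _ := by field_simp; ring
  have d4 : 1 / (ε * Q) ^ 2 * (#(edgeSets D) * ((k + 1) * Q)) =
      #(edgeSets D) * ((k + 1) / (ε ^ 2 * Q)) := by
    field_simp
  have e1 := mul_le_mul_of_nonneg_left b1 (show 0 ≤ 144 / μ ^ 2 by positivity)
  have e2 := mul_le_mul_of_nonneg_left b2 (show 0 ≤ 80 / (3 * μ ^ 2) by positivity)
  have e3 := mul_le_mul_of_nonneg_left b3 (show 0 ≤ 40 / (ε * Q * μ) by positivity)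
  have e4 := mul_le_mul_of_nonneg_left b4 (show 0 ≤ 1 / (ε * Q) ^ 2 by positivity)
  have f1 : #(edgeSets D) * (144 / R) + #(edgeSets D) * (2560 / (3 * R)) ≤
      #(edgeSets D) * (1000 / R) := by
    rw [← mul_add]
    refine mul_le_mul_of_nonneg_left ?_ hN
    rw [div_add_div _ _ hR0.ne' (by positivity), div_le_div_iff₀ (by positivity) hR0]
    nlinarith
  rw [mul_add, mul_add]
  linarith

end GiantComponent

/-! ### Translation between the measures and finite sums -/

section Law

instance instMeasurableSingletonClass {n : ℕ} : MeasurableSingletonClass (SimpleGraph (Fin n)) where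
  measurableSet_singleton G := by
    have h : ({G} : Set (SimpleGraph (Fin n))) = SimpleGraph.edgeSet ⁻¹' {G.edgeSet} := by
      ext H
      simp
    rw [h]
    exact SimpleGraph.measurable_edgeSet (measurableSet_singleton _)

theorem mem_edgeSets {V : Type*} [Fintype V] [DecidableEq V] {D : V → ℕ} {E : Finset (Sym2 V)} :
    E ∈ edgeSets D ↔ (∀ e ∈ E, ¬ e.IsDiag) ∧ ∀ x, edgeDeg E x = D x := by
  simp [edgeSets]

variable {n : ℕ} {D : Fin n → ℕ}

theorem setBernoulli_real_eq_bernExp {α : Type*} [Fintype α] (E : Finset α) (p : unitInterval)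
    [DecidableEq α] (A : Set (Set α)) : (setBernoulli (E : Set α) p).real A =
      bernExp (p : ℝ) E (fun T => if (T : Set α) ∈ A then 1 else 0) := by
  have h1 : (setBernoulli (E : Set α) p).real A =
      ∑ s : Set α, if s ∈ A then (setBernoulli (E : Set α) p).real {s} else 0 := by
    rw [← sum_filter, sum_measureReal_singleton]
    simp
  rw [h1, ← Fintype.finsetEquivSet.sum_comp, bernExp,
    ← sum_subset (subset_univ E.powerset) fun T _ hT => ?_]
  · refine sum_congr rfl fun T hT => ?_
    have hT' := mem_powerset.1 hT
    rw [Fintype.finsetEquivSet_apply]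
    split_ifs
    · rw [setBernoulli_real_singleton p (by exact_mod_cast hT') E.finite_toSet,
        Set.ncard_coe_finset, ← coe_sdiff, Set.ncard_coe_finset]
      ring
    · ring
  · rw [Fintype.finsetEquivSet_apply, measureReal_def,
      setBernoulli_singleton_of_not_subset p (by simpa using hT)]
    simp

theorem percolation_real (G : SimpleGraph (Fin n)) (p : unitInterval)
    (A : Set (SimpleGraph (Fin n))) : (percolation G p).real A = bernExp (p : ℝ) G.edgeFinset
      (fun T => if SimpleGraph.fromEdgeSet (T : Set (Sym2 (Fin n))) ∈ A then 1 else 0) := by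
  rw [percolation, map_measureReal_apply SimpleGraph.measurable_fromEdgeSet A.toFinite.measurableSet,
    ← SimpleGraph.coe_edgeFinset, setBernoulli_real_eq_bernExp]
  rfl

theorem edgeDeg_edgeFinset (G : SimpleGraph (Fin n)) (i : Fin n) :
    edgeDeg G.edgeFinset i = (G.neighborSet i).ncard := by
  rw [← card_filter_mk_mem, ← Set.ncard_coe_finset]
  congr 1
  ext j
  simp

theorem mem_edgeSets_edgeFinset (G : SimpleGraph (Fin n)) :
    G.edgeFinset ∈ edgeSets D ↔ G ∈ realizations D := by
  simp only [mem_edgeSets, realizations, Set.mem_ofPred_eq,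
    edgeDeg_edgeFinset, and_iff_right_iff_imp]
  exact fun _ e he => G.not_isDiag_of_mem_edgeFinset he

theorem edgeFinset_fromEdgeSet {T : Finset (Sym2 (Fin n))} (hT : ∀ e ∈ T, ¬ e.IsDiag)
    {H : SimpleGraph (Fin n)} (hH : H = SimpleGraph.fromEdgeSet (T : Set (Sym2 (Fin n)))) :
    H.edgeFinset = T := by
  ext e
  rw [SimpleGraph.mem_edgeFinset, hH, SimpleGraph.edgeSet_fromEdgeSet]
  simpa using fun h => hT e h

theorem sum_edgeSets (f : Finset (Sym2 (Fin n)) → ℝ) :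
    ∑ E ∈ edgeSets D, f E = ∑ G : SimpleGraph (Fin n) with G ∈ realizations D, f G.edgeFinset := by
  symm
  refine sum_bij (fun G _ => G.edgeFinset) (fun G hG => ?_) (fun G _ H _ h => ?_)
    (fun E hE => ?_) fun G _ => rfl
  · exact (mem_edgeSets_edgeFinset G).2 (mem_filter.1 hG).2
  · exact SimpleGraph.edgeFinset_inj.1 h
  · refine ⟨_, mem_filter.2 ⟨mem_univ _, (mem_edgeSets_edgeFinset _).1 ?_⟩,
      edgeFinset_fromEdgeSet (mem_edgeSets.1 hE).1 rfl⟩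
    rwa [edgeFinset_fromEdgeSet (mem_edgeSets.1 hE).1 rfl]

theorem percolatedLaw_real (hD : IsFeasible D) (p : unitInterval)
    (A : Set (SimpleGraph (Fin n))) : #(edgeSets D) * (percolatedLaw D p).real A =
      totalExp (p : ℝ) D fun _ T =>
        if SimpleGraph.fromEdgeSet (T : Set (Sym2 (Fin n))) ∈ A then 1 else 0 := by
  have hc : (#(edgeSets D) : ℝ) = #({G | G ∈ realizations D} : Finset (SimpleGraph (Fin n))) := by
    have := sum_edgeSets (D := D) fun _ => 1
    simpa using this
  have hu : ∀ G, (uniformOn (realizations D)).real {G} =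
      if G ∈ realizations D then (#(edgeSets D) : ℝ)⁻¹ else 0 := by
    intro G
    have hR : realizations D = (({G | G ∈ realizations D} : Finset (SimpleGraph (Fin n))) : Set _) := by
      simp
    rw [measureReal_def]
    conv_lhs => rw [hR, ← coe_singleton, uniformOn_apply_finset]
    rw [hc, inter_singleton]
    clear hR
    split_ifs with h1 h2 h2 <;> simp_all
  have hN : (#(edgeSets D) : ℝ) ≠ 0 := by
    obtain ⟨G, hG⟩ := hD
    exact_mod_cast (card_pos.2 ⟨_, (mem_edgeSets_edgeFinset G).2 hG⟩).ne'
  have hp : ∀ G : SimpleGraph (Fin n), IsProbabilityMeasure (percolation G p) := fun G =>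
    Measure.isProbabilityMeasure_map SimpleGraph.measurable_fromEdgeSet.aemeasurable
  have hl : (percolatedLaw D p).real A =
      ∑ G, (percolation G p).real A * (uniformOn (realizations D)).real {G} := by
    rw [measureReal_def, percolatedLaw, Measure.bind_apply A.toFinite.measurableSet
      (Measurable.of_discrete).aemeasurable, lintegral_fintype, ENNReal.toReal_sum]
    · exact sum_congr rfl fun G _ => ENNReal.toReal_mul
    · intro G _
      exact ENNReal.mul_ne_top (measure_ne_top _ _) (measure_ne_top _ _)
  rw [hl, totalExp, sum_edgeSets, mul_sum, sum_filter]
  refine sum_congr rfl fun G _ => ?_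
  rw [hu, ← percolation_real]
  split_ifs
  · field_simp
  · ring

end Law

/-! ### The core set and the choice of parameters -/

section Main

variable {n : ℕ} {D : Fin n → ℕ}

theorem fromEdgeSet_edgeFinset (H : SimpleGraph (Fin n)) :
    SimpleGraph.fromEdgeSet (H.edgeFinset : Set (Sym2 (Fin n))) = H := by
  simp

theorem isProbabilityMeasure_percolatedLaw (hD : IsFeasible D) (p : unitInterval) :
    IsProbabilityMeasure (percolatedLaw D p) := by
  have h1 : IsProbabilityMeasure (uniformOn (realizations D)) :=
    isProbabilityMeasure_uniformOn (Set.toFinite _) hD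
  have h2 : ∀ G : SimpleGraph (Fin n), IsProbabilityMeasure (percolation G p) := fun G =>
    Measure.isProbabilityMeasure_map SimpleGraph.measurable_fromEdgeSet.aemeasurable
  constructor
  rw [percolatedLaw, Measure.bind_apply MeasurableSet.univ Measurable.of_discrete.aemeasurable]
  simp

theorem card_edgeSets_pos (hD : IsFeasible D) : (0 : ℝ) < #(edgeSets D) := by
  obtain ⟨G, hG⟩ := hD
  exact_mod_cast card_pos.2 ⟨_, (mem_edgeSets_edgeFinset G).2 hG⟩

theorem mem_highVerts_iff {H : SimpleGraph (Fin n)} {w : ℝ} {v : Fin n} :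
    v ∈ highVerts H w ↔ ⌈w⌉₊ ≤ edgeDeg H.edgeFinset v := by
  rw [edgeDeg_edgeFinset, Nat.ceil_le]
  rfl

theorem ncard_highVerts_inter (H : SimpleGraph (Fin n)) (w : ℝ) (S : Set (Fin n)) :
    ((highVerts H w ∩ S).ncard : ℝ) =
      ∑ v, if v ∈ S then highInd ⌈w⌉₊ H.edgeFinset v else 0 := by
  rw [Set.ncard_eq_toFinset_card', card_eq_sum_ones, Nat.cast_sum, ← sum_filter]
  unfold highInd
  rw [← sum_filter, filter_filter]
  refine sum_congr ?_ fun v _ => by simp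
  ext v
  simp [mem_highVerts_iff, and_comm]

theorem ncard_highVerts (H : SimpleGraph (Fin n)) (w : ℝ) :
    ((highVerts H w).ncard : ℝ) = ∑ v, highInd ⌈w⌉₊ H.edgeFinset v := by
  have := ncard_highVerts_inter H w Set.univ
  simpa using this

theorem expectedHigh_eq (hD : IsFeasible D) (p : unitInterval) (w : ℝ) {Q : ℝ}
    (hQ : ∀ E ∈ edgeSets D, ∑ v, highProb p ⌈w⌉₊ E v = Q) : expectedHigh D p w = Q := by
  have := isProbabilityMeasure_percolatedLaw hD p
  have h1 : expectedHigh D p w = ∑ v, (percolatedLaw D p).real {H | v ∈ highVerts H w} := by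
    have : ∀ H : SimpleGraph (Fin n), ((highVerts H w).ncard : ℝ) =
        ∑ v, Set.indicator {H | v ∈ highVerts H w} (fun _ => (1 : ℝ)) H := fun H => by
      rw [ncard_highVerts]
      refine sum_congr rfl fun v _ => ?_
      unfold highInd Set.indicator
      simp only [Set.mem_ofPred_eq, mem_highVerts_iff]
    simp only [expectedHigh, this]
    rw [integral_finsetSum _ fun v _ => Integrable.of_finite]
    refine sum_congr rfl fun v _ => ?_
    exact integral_indicator_one (Set.toFinite _).measurableSet
  have hN := card_edgeSets_pos hD
  refine mul_left_cancel₀ hN.ne' ?_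
  rw [h1, mul_sum]
  simp only [percolatedLaw_real hD]
  rw [← totalExp_sum, ← nsmul_eq_mul, ← sum_const]
  refine sum_congr rfl fun E hE => ?_
  rw [← hQ E hE]
  unfold highProb
  rw [← bernExp_sum]
  refine bernExp_congr fun T hT => sum_congr rfl fun v _ => ?_
  rw [Set.mem_ofPred_eq, mem_highVerts_iff, edgeFinset_fromEdgeSet
    (fun e he => (mem_edgeSets.1 hE).1 e (hT he)) rfl]
  unfold highInd
  congr

/-- A vertex of S has at most |S| neighbours in S, and edges leaving S are charged to their other
end. Applied to the high-degree vertices, this shows that there are many of them. -/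
theorem degSum_le_card_sq (hD : IsFeasible D) (S : Finset (Fin n)) :
    degSum D S ≤ (#S : ℝ) ^ 2 + degSum D Sᶜ := by
  obtain ⟨G, hG⟩ := hD
  have hd : ∀ i, (D i : ℝ) = ∑ j, if G.Adj i j then (1 : ℝ) else 0 := fun i => by
    rw [← hG i, Set.ncard_eq_toFinset_card', ← sum_filter, sum_const, nsmul_eq_mul, mul_one]
    congr 2
    ext j
    simp
  have h1 : ∀ i, (D i : ℝ) ≤ #S + ∑ j ∈ Sᶜ, if G.Adj i j then (1 : ℝ) else 0 := fun i => by
    rw [hd, ← sum_add_sum_compl S]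
    gcongr
    refine (sum_le_sum (g := fun _ => 1) fun j _ => ?_).trans (by simp)
    split_ifs <;> norm_num
  have h2 : ∑ i ∈ S, ∑ j ∈ Sᶜ, (if G.Adj i j then (1 : ℝ) else 0) ≤ degSum D Sᶜ := by
    rw [sum_comm, degSum]
    refine sum_le_sum fun j _ => ?_
    rw [hd]
    simp only [G.adj_comm _ j]
    refine sum_le_sum_of_subset_of_nonneg (subset_univ S) fun i _ _ => ?_
    split_ifs <;> norm_num
  refine (sum_le_sum fun i _ => h1 i).trans ?_
  rw [sum_add_distrib, sum_const, nsmul_eq_mul, sq]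
  gcongr

theorem le_card_of_feasible (hD : IsFeasible D) (i : Fin n) : D i ≤ n := by
  obtain ⟨G, hG⟩ := hD
  rw [← hG i]
  simpa using Set.ncard_le_card (G.neighborSet i)

/-- A set `W` of vertices carrying almost all of the degrees, with large average degree. -/
theorem exists_core (hD : IsFeasible D) (hpos : ∀ i, 1 ≤ D i) (hn : 0 < n) {p d R : ℝ}
    (h0 : 0 ≤ p) (h1 : p ≤ 1) (hR : 2 ≤ R) (hpd : R ≤ p * d)
    (hS : min (R * degSum D (largeDegree D d)ᶜ) (d * n) ≤ degSum D (largeDegree D d)) :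
    (∃ W, R * #W ≤ p * degSum D W ∧ R * (p * degSum D Wᶜ) ≤ p * degSum D W ∧
      R ≤ p * degSum D W) ∧ R / 2 ≤ #(largeDegree D d) := by
  set S := largeDegree D d with hSdef
  have hd : R ≤ d := by
    have : 0 < d := by
      by_contra h
      push Not at h
      nlinarith
    nlinarith
  have hSd : d * #S ≤ degSum D S := by
    rw [mul_comm, ← nsmul_eq_mul]
    exact card_nsmul_le_sum _ _ _ fun v hv => (mem_filter.1 hv).2
  have hn' : (1 : ℝ) ≤ n := by exact_mod_cast hn
  have hnn : ∀ U : Finset (Fin n), 0 ≤ degSum D U := fun U => sum_nonneg fun _ _ => by positivity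
  -- If S carries almost all of the degrees, the core is S. Otherwise d(S) ≥ dn, so the whole vertex
  -- set already has average degree at least d and serves as the core.
  rcases min_le_iff.1 hS with hA | hB
  · have hS1 : 1 ≤ #S := by
      by_contra h
      have hS0 : S = ∅ := by
        rw [← card_eq_zero]
        omega
      rw [hS0, compl_empty, degSum, degSum, sum_empty] at hA
      have : (1 : ℝ) ≤ D ⟨0, hn⟩ := by exact_mod_cast hpos _
      have h3 := single_le_sum (f := fun i => (D i : ℝ)) (fun i _ => by positivity)
        (mem_univ (⟨0, hn⟩ : Fin n))
      nlinarith
    have hS1' : (1 : ℝ) ≤ #S := by exact_mod_cast hS1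
    have hm : R * #S ≤ p * degSum D S := by
      calc R * #S ≤ p * d * #S := by gcongr
        _ = p * (d * #S) := by ring
        _ ≤ _ := by gcongr
    refine ⟨⟨S, hm, ?_, by nlinarith⟩, ?_⟩
    · rw [mul_left_comm]
      gcongr
    -- From d|S| ≤ d(S) ≤ |S|² + d(Sᶜ) and d(Sᶜ) ≤ d(S)/2 it follows that |S| ≥ d/2.
    · have h3 := degSum_le_card_sq hD S
      have h4 : 2 * degSum D Sᶜ ≤ degSum D S := by nlinarith [hnn Sᶜ]
      have h5 : d / 2 * #S ≤ #S * #S := by nlinarith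
      have := le_of_mul_le_mul_right h5 (by linarith)
      linarith
  · have hle : degSum D S ≤ degSum D univ :=
      sum_le_sum_of_subset_of_nonneg (subset_univ _) fun _ _ _ => by positivity
    have hm : R * n ≤ p * degSum D univ := by
      calc R * n ≤ p * d * n := by gcongr
        _ = p * (d * n) := by ring
        _ ≤ _ := by
          gcongr
          linarith
    refine ⟨⟨univ, by simpa using hm, ?_, by nlinarith⟩, ?_⟩
    · rw [compl_univ, degSum, sum_empty, mul_zero, mul_zero]
      exact mul_nonneg h0 (hnn _)
    · have h3 : degSum D S ≤ #S * n := by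
        rw [← nsmul_eq_mul]
        exact sum_le_card_nsmul _ _ _ fun v _ => by exact_mod_cast le_card_of_feasible hD v
      have := le_of_mul_le_mul_right (hB.trans h3) (by linarith)
      linarith

theorem exists_component_of_concentrated {H : SimpleGraph (Fin n)} {w ε Q : ℝ}
    (h : Concentrated ⌈w⌉₊ ε Q H.edgeFinset) :
    (∃ c : H.ConnectedComponent, (1 - ε) * ((highVerts H w).ncard : ℝ) ≤
      ((highVerts H w ∩ c.supp).ncard : ℝ)) ∧ (1 - ε) * Q ≤ ((highVerts H w).ncard : ℝ) := by
  obtain ⟨⟨c, hc⟩, hQ⟩ := h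
  rw [ncard_highVerts]
  refine ⟨⟨H.connectedComponentMk c, hc.trans_eq ?_⟩, hQ⟩
  rw [ncard_highVerts_inter]
  refine sum_congr rfl fun v _ => ?_
  simp only [Reach, fromEdgeSet_edgeFinset, SimpleGraph.ConnectedComponent.mem_supp_iff,
    SimpleGraph.ConnectedComponent.eq]

theorem ncard_supp_le_largestOrder {H : SimpleGraph (Fin n)} (c : H.ConnectedComponent) :
    c.supp.ncard ≤ largestOrder H :=
  le_ciSup (f := fun c : H.ConnectedComponent => c.supp.ncard) (Set.finite_range _).bddAbove c

/-- Here x = √ω, ε = 1/x and R = x⁶. The last term is the variance term; it is at most 6/x², well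
below ε. The threshold 16 also makes 3480/x⁵ at most 1/(16x). -/
theorem failure_bound {x k Q : ℝ} (hx : 16 ≤ x) (hk : k ≤ x ^ 2 + 1)
    (hQ : x ^ 6 / 4 ≤ Q) :
    1000 / x ^ 6 + 3480 / (x⁻¹ * x ^ 6) + (k + 1) / (x⁻¹ ^ 2 * Q) ≤ x⁻¹ := by
  have hx0 : 0 < x := by linarith
  have h1 : 1000 / x ^ 6 ≤ x⁻¹ / 16 := by
    rw [div_le_div_iff₀ (by positivity) (by norm_num), inv_mul_eq_div, le_div_iff₀ hx0]
    have : (16 : ℝ) ^ 5 ≤ x ^ 5 := by gcongr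
    nlinarith
  have h2 : 3480 / (x⁻¹ * x ^ 6) ≤ x⁻¹ / 16 := by
    rw [show x⁻¹ * x ^ 6 = x ^ 5 by field_simp, div_le_div_iff₀ (by positivity) (by norm_num),
      inv_mul_eq_div, le_div_iff₀ hx0]
    have : (16 : ℝ) ^ 4 ≤ x ^ 4 := by gcongr
    nlinarith
  have h3 : (k + 1) / (x⁻¹ ^ 2 * Q) ≤ x⁻¹ * (3 / 4) := by
    calc (k + 1) / (x⁻¹ ^ 2 * Q) ≤ (3 / 2 * x ^ 2) / (x⁻¹ ^ 2 * (x ^ 6 / 4)) := by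
          gcongr
          nlinarith
      _ = x⁻¹ * (6 / x) := by
          field_simp
          ring
      _ ≤ _ := by
          refine mul_le_mul_of_nonneg_left ?_ (by positivity)
          rw [div_le_div_iff₀ hx0 (by norm_num)]
          linarith
  have : 0 < x⁻¹ := by positivity
  linarith

theorem percolatedLaw_real_concentrated (hD : IsFeasible D) (hpos : ∀ i, 1 ≤ D i) (hn : 0 < n)
    {p : unitInterval} {d w : ℝ} (hw : 256 ≤ w) (hpd : w ^ 3 ≤ p * d)
    (hS : min (w ^ 3 * degSum D (largeDegree D d)ᶜ) (d * n) ≤ degSum D (largeDegree D d)) :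
    1 - w ^ (-(1 / 2) : ℝ) ≤ (percolatedLaw D p).real {H | Concentrated ⌈w⌉₊
      (w ^ (-(1 / 2) : ℝ)) (expectedHigh D p w) H.edgeFinset} := by
  have hprob := isProbabilityMeasure_percolatedLaw hD p
  obtain ⟨h0, h1⟩ := p.2
  obtain ⟨x, hx, rfl⟩ : ∃ x : ℝ, 16 ≤ x ∧ w = x ^ 2 :=
    ⟨√w, Real.le_sqrt_of_sq_le (by linarith), (Real.sq_sqrt (by linarith)).symm⟩
  have hx0 : 0 < x := by linarith
  have hε : (x ^ 2) ^ (-(1 / 2) : ℝ) = x⁻¹ := by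
    rw [← Real.rpow_natCast, ← Real.rpow_mul hx0.le]
    norm_num [Real.rpow_neg_one]
  have hx6 : (16 : ℝ) ^ 6 ≤ (x ^ 2) ^ 3 := by
    rw [← pow_mul]
    gcongr
  have hk1 : (⌈x ^ 2⌉₊ : ℝ) ≤ x ^ 2 + 1 := (Nat.ceil_lt_add_one (by positivity)).le
  rw [hε]
  obtain ⟨⟨W, hW, hWc, hWR⟩, hSc⟩ := exists_core hD hpos hn h0 h1 (by linarith) hpd hS
  obtain ⟨G, hG⟩ := id hD
  obtain ⟨Q, hQdef⟩ : ∃ Q, Q = ∑ v, highProb p ⌈x ^ 2⌉₊ G.edgeFinset v := ⟨_, rfl⟩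
  have hGE := (mem_edgeSets_edgeFinset (D := D) G).2 hG
  have hQ : ∀ E ∈ edgeSets D, ∑ v, highProb p ⌈x ^ 2⌉₊ E v = Q := fun E hE => by
    rw [hQdef]
    refine sum_congr rfl fun v _ => highProb_congr ?_
    rw [(mem_edgeSets.1 hE).2, (mem_edgeSets.1 hGE).2]
  rw [expectedHigh_eq hD p _ hQ]
  -- There are at least R/2 vertices of host degree at least d, and each has percolated degree at
  -- least ω with probability at least 1/2.
  have hQS : (x ^ 2) ^ 3 / 4 ≤ Q := by
    have h : #(largeDegree D d) • (1 / 2 : ℝ) ≤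
        ∑ v ∈ largeDegree D d, highProb p ⌈x ^ 2⌉₊ G.edgeFinset v := by
      refine card_nsmul_le_sum _ _ _ fun v hv => ?_
      have hv : d ≤ D v := (mem_filter.1 hv).2
      have hpv : (x ^ 2) ^ 3 ≤ p * D v := hpd.trans (mul_le_mul_of_nonneg_left hv h0)
      refine half_le_highProb h0 h1 ?_ ?_ <;> rw [(mem_edgeSets.1 hGE).2]
      · nlinarith [pow_le_pow_left₀ (by norm_num) hw 2]
      · linarith
    rw [nsmul_eq_mul] at h
    have h' : ∑ v ∈ largeDegree D d, highProb p ⌈x ^ 2⌉₊ G.edgeFinset v ≤ Q := by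
      rw [hQdef]
      exact sum_le_sum_of_subset_of_nonneg (subset_univ _) fun _ _ _ => highProb_nonneg h0 h1
    linarith
  have hfin := totalExp_not_concentrated_le (D := D) (W := W) h0 h1
    (k := ⌈x ^ 2⌉₊) (Nat.ceil_pos.2 (by positivity)) (ε := x⁻¹) (Q := Q) rfl
    (le_trans (by linarith) hWR) hW hWc (by linarith) hWR (by positivity)
    ((inv_le_comm₀ hx0 (by norm_num)).2 (by linarith)) hQ (by linarith)
  have hN := card_edgeSets_pos hD
  set A : Set (SimpleGraph (Fin n)) :=
    {H | Concentrated ⌈x ^ 2⌉₊ x⁻¹ Q H.edgeFinset} with hA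
  have hle : #(edgeSets D) * (percolatedLaw D p).real Aᶜ ≤ #(edgeSets D) * x⁻¹ := by
    rw [percolatedLaw_real hD]
    refine le_trans (le_of_eq ?_) (hfin.trans (mul_le_mul_of_nonneg_left ?_ hN.le))
    · refine sum_congr rfl fun E hE => bernExp_congr fun T hT => ?_
      beta_reduce
      rw [hA, Set.mem_compl_iff, Set.mem_ofPred_eq, edgeFinset_fromEdgeSet
        (fun e he => (mem_edgeSets.1 hE).1 e (hT he)) rfl]
      split_ifs <;> rfl
    · have h6 : (x ^ 2) ^ 3 = x ^ 6 := by ring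
      rw [h6] at hQS ⊢
      exact failure_bound hx hk1 hQS
  have hc := le_of_mul_le_mul_left hle hN
  rw [probReal_compl_eq_one_sub A.toFinite.measurableSet] at hc
  linarith

end Main

end DegreePercolation

end

theorem mainTheorem9 :
    ∃ C : ℝ, 0 < C ∧
      ∀ (D : (n : ℕ) → Fin n → ℕ) (d : ℕ → ℝ) (p : ℕ → unitInterval) (ω : ℕ → ℝ),
        (∀ᶠ n in atTop, IsFeasible (D n)) →
        (∀ᶠ n in atTop, ∀ i, 1 ≤ D n i) →
        Tendsto ω atTop atTop →
        (∀ᶠ n in atTop, ω n ^ 3 ≤ (p n : ℝ) * d n) →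
        (∀ᶠ n in atTop,
          min (ω n ^ 3 * degSum (D n) (largeDegree (D n) (d n))ᶜ) (d n * (n : ℝ))
            ≤ degSum (D n) (largeDegree (D n) (d n))) →
        ∀ᶠ n in atTop,
          1 - C * ω n ^ (-(1 / 2) : ℝ) ≤
            (percolatedLaw (D n) (p n)).real
              {H | (1 - C * ω n ^ (-(1 / 2) : ℝ)) * expectedHigh (D n) (p n) (ω n)
                ≤ (largestOrder H : ℝ)} ∧
          1 - C * ω n ^ (-(1 / 2) : ℝ) ≤
            (percolatedLaw (D n) (p n)).real
              {H | ∃ c : H.ConnectedComponent,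
                (1 - C * ω n ^ (-(1 / 2) : ℝ)) * ((highVerts H (ω n)).ncard : ℝ)
                  ≤ ((highVerts H (ω n) ∩ c.supp).ncard : ℝ)} := by
  -- The constant 2 comes from (1-ε)² ≥ 1 - 2ε: one factor for the vertices missed by the component,
  -- one for the deviation of |V_ω| from its mean.
  refine ⟨2, by norm_num, fun D d p ω hD hpos hω hpd hS => ?_⟩
  filter_upwards [hD, hpos, hω.eventually_ge_atTop 256, hpd, hS, eventually_gt_atTop 0] with
    n hD hpos hω hpd hS hn
  have := DegreePercolation.isProbabilityMeasure_percolatedLaw hD (p n)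
  have h := DegreePercolation.percolatedLaw_real_concentrated hD hpos hn hω hpd (by convert hS)
  have hε0 : 0 < ω n ^ (-(1 / 2) : ℝ) := Real.rpow_pos_of_pos (by linarith) _
  have hε1 : ω n ^ (-(1 / 2) : ℝ) ≤ 1 :=
    Real.rpow_le_one_of_one_le_of_nonpos (by linarith) (by norm_num)
  generalize ω n ^ (-(1 / 2) : ℝ) = ε at *
  have hQ : 0 ≤ expectedHigh (D n) (p n) (ω n) := integral_nonneg fun _ => Nat.cast_nonneg _
  generalize expectedHigh (D n) (p n) (ω n) = Q at *
  constructor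
  · refine le_trans (by linarith) (h.trans (measureReal_mono fun H hH => ?_))
    obtain ⟨⟨c, hc⟩, hQH⟩ := DegreePercolation.exists_component_of_concentrated hH
    have h1 : ((highVerts H (ω n) ∩ c.supp).ncard : ℝ) ≤ largestOrder H := by
      exact_mod_cast (Set.ncard_le_ncard Set.inter_subset_right).trans
        (DegreePercolation.ncard_supp_le_largestOrder c)
    have h2 := mul_le_mul_of_nonneg_left hQH (sub_nonneg.2 hε1)
    refine le_trans ?_ (h2.trans (hc.trans h1))
    nlinarith [mul_nonneg (sq_nonneg ε) hQ]
  · refine le_trans (by linarith) (h.trans (measureReal_mono fun H hH => ?_))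
    obtain ⟨⟨c, hc⟩, -⟩ := DegreePercolation.exists_component_of_concentrated hH
    refine ⟨c, le_trans ?_ hc⟩
    have : (0 : ℝ) ≤ (highVerts H (ω n)).ncard := Nat.cast_nonneg _
    nlinarith
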